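/- **Model.** Let $n,p\ge 1$, and let $X\in\mathbb R^{n\times p}$ have independent entries $X_{ij}\sim N(\mu_{ij},\sigma^2)$, with unknown $\mu$ and $\sigma>0$. The observations $1,\dots,n$ are divided into $K^*$ nonempty true clusters, and any two observations $i,i'$ in the same true cluster have the same mean vector, $\mu_i=\mu_{i'}$. **Randomized clustering.** Let $d(M;X)\in\mathbb R$ be any dissimilarity (linkage) between the two clusters of a pair $M=(C_1,C_2)$, measurable in $X$, and let $\tau>0$. Start from the singletons $\{1\},\dots,\{n\}$. At each step $t=1,\dots,n-1$ let $\mathcal M^{(t)}$ be the set of all unordered pairs of distinct current clusters. Given $X=x$ and the earlier merges, draw the merge $M^{(t)}=M\in\mathcal M^{(t)}$ with probability $$p^{(t)}(M;x)=\frac{e^{-d(M;x)/\tau^{(t)}}}{\sum_{M'\in\mathcal M^{(t)}}e^{-d(M';x)/\tau^{(t)}}},\qquad \tau^{(t)}=\frac{\tau}{|\mathcal M^{(t)}|}\sum_{M'\in\mathcal M^{(t)}}d(M';x)$$ (with $1/0:=0$), and replace the two clusters of $M^{(t)}$ by their union. **p-values.** Write $M^{(t)}=(C_1,C_2)$ and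 $N=|C_1|+|C_2|$. Let $B$ be the orthogonal projection of $\mathbb R^n$ onto the line spanned by $\mathbf 1_{C_1}/|C_1|-\mathbf 1_{C_2}/|C_2|$, and let $W=\sum_{j=1}^2\big(I_{C_j}-\mathbf 1_{C_j}\mathbf 1_{C_j}^\top/|C_j|\big)$, where $I_C$ is the diagonal matrix with diagonal $\mathbf 1_C$. The test statistic of $H_0^{(t)}$: "$\mu_i=\mu_{i'}$ for all $i,i'\in C_1\cup C_2$" is $R^{(t)}=(N-2)\|BX\|_F^2/\|WX\|_F^2$. For $r>0$ put $$X(r)=\sqrt{\|BX\|_F^2+\|WX\|_F^2}\left(\sqrt{\tfrac{r}{N-2+r}}\,\tfrac{BX}{\|BX\|_F}+\sqrt{\tfrac{N-2}{N-2+r}}\,\tfrac{WX}{\|WX\|_F}\right)+(I_n-B-W)X .$$ With $\ell$ the density of the $F_{p,(N-2)p}$ distribution, the p-value of step $t$ is $$\mathbf P^{(t)}=1-\frac{\int_0^{R^{(t)}}\ell(r)\prod_{s=1}^{t}p^{(s)}(M^{(s)};X(r))\,dr}{\int_0^{\infty}\ell(r)\prod_{s=1}^{t}p^{(s)}(M^{(s)};X(r))\,dr}.$$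 **Adaptive $\alpha$-spending.** Fix $\alpha_1,\dots,\alpha_{n-1}\ge 0$ with $\sum_{j=1}^{n-1}\alpha_j=\alpha$, a cutoff $n_{\min}\ge 1$ and a threshold $n^*\in\mathbb R$. Let $\mathcal S$ be the multiset $\{\alpha_1,\dots,\alpha_{n-1}\}$. For $t=1,\dots,n-1$, let $k$ be the smaller of the sizes of the two clusters merged at step $t$. If $k\le n_{\min}$, make no test and go on to the next step. Otherwise let $\alpha^{(t)}=\min\mathcal S$ if $k\le n^*$ and $\alpha^{(t)}=\max\mathcal S$ if $k>n^*$, and remove one copy of $\alpha^{(t)}$ from $\mathcal S$. If $\mathbf P^{(t)}<\alpha^{(t)}$, stop with $\widehat K=n-t+1$. If no step rejects, set $\widehat K=1$. **Theorem.** Let $\mathcal T$ be the event that no merge before step $n-K^*+1$ is a cross-cluster merge, that is, for every $t<n-K^*+1$ all observations in the two clusters merged at step $t$ belong to one true cluster. Then $$\mathbb P\big(\{\widehat K>K^*\}\cap\mathcal T\big)\le\alpha .$$ -/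

import Mathlib

open MeasureTheory
open scoped NNReal ENNReal

noncomputable section

namespace RandClust

/-- An `n × p` data matrix: row `i` is the observation `X i`. -/
abbrev Data (n p : ℕ) : Type := Fin n → Fin p → ℝ

/-- A merge is a pair of clusters, a cluster being a set of observations. -/
abbrev Merge (n : ℕ) : Type := Finset (Fin n) × Finset (Fin n)

/-- The law of a data matrix whose entries are independent, entry `(i, j)` being normal with
mean `μ i j` and variance `σ ^ 2`, that is, the matrix normal law `MN(μ, I, σ² I)`. -/
def gaussianData {n p : ℕ} (μ : Data n p) (σ : ℝ≥0) : Measure (Data n p) :=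
  Measure.pi fun i => Measure.pi fun j => ProbabilityTheory.gaussianReal (μ i j) (σ ^ 2)

/-! ### Randomized agglomerative clustering

A merge history is a sequence `m : ℕ → Merge n`, where `m t` is the merge made at step `t`
for `1 ≤ t ≤ n - 1` (the other values play no role). -/

/-- The set of clusters that exist after the first `t` merges of the history `m`.
At step `t` the algorithm chooses among pairs of elements of `clustersAfter m (t - 1)`. -/
def clustersAfter {n : ℕ} (m : ℕ → Merge n) : ℕ → Finset (Finset (Fin n))
  | 0 => Finset.univ.image fun i => {i}
  | t + 1 => (clustersAfter m t \ {(m (t + 1)).1, (m (t + 1)).2}) ∪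
      {(m (t + 1)).1 ∪ (m (t + 1)).2}

/-- The candidate merges: all unordered pairs of distinct clusters. Each pair is listed once,
the cluster that contains the smallest index coming first. -/
def candidates {n : ℕ} (C : Finset (Finset (Fin n))) : Finset (Merge n) :=
  (C ×ˢ C).filter fun M => M.1.min < M.2.min

/-- The amount of randomization at a step: `τ` times the average dissimilarity over the
candidate merges. -/
def tauStep {n p : ℕ} (d : Merge n → Data n p → ℝ) (τ : ℝ) (C : Finset (Finset (Fin n)))
    (x : Data n p) : ℝ :=
  τ * ((∑ M ∈ candidates C, d M x) / ((candidates C).card : ℝ))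

/-- The probability that the merge `M` is selected when the current clusters are `C` and the
data matrix is `x`: the softmax of minus the dissimilarities divided by `tauStep`. -/
def selProb {n p : ℕ} (d : Merge n → Data n p → ℝ) (τ : ℝ) (C : Finset (Finset (Fin n)))
    (M : Merge n) (x : Data n p) : ℝ :=
  if M ∈ candidates C then
    Real.exp (-(1 / tauStep d τ C x) * d M x) /
      ∑ N ∈ candidates C, Real.exp (-(1 / tauStep d τ C x) * d N x)
  else 0

/-- The probability, given that the data matrix is `x`, that the first `t` merges are
`m 1, …, m t`; the merges are sampled independently given the data. -/
def historyProb {n p : ℕ} (d : Merge n → Data n p → ℝ) (τ : ℝ) (m : ℕ → Merge n) (t : ℕ)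
    (x : Data n p) : ℝ :=
  ∏ s ∈ Finset.Icc 1 t, selProb d τ (clustersAfter m (s - 1)) (m s) x

/-- `X` is a Gaussian data matrix with mean `μ` and noise level `σ`, and `M 1, …, M (n - 1)` are
the random merges that randomized agglomerative clustering with dissimilarity `d` and
randomization parameter `τ` makes on `X`. -/
structure IsClusteringRun {n p : ℕ} {Ω : Type*} [MeasurableSpace Ω] (P : Measure Ω)
    (μ : Data n p) (σ : ℝ≥0) (d : Merge n → Data n p → ℝ) (τ : ℝ)
    (X : Ω → Data n p) (M : ℕ → Ω → Merge n) : Prop where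
  measurable_data : Measurable X
  law_data : P.map X = gaussianData μ σ
  measurable_merge : ∀ t ∈ Finset.Icc 1 (n - 1), ∀ c, MeasurableSet {ω | M t ω = c}
  law_merges : ∀ t ≤ n - 1, ∀ m : ℕ → Merge n, ∀ A : Set (Data n p), MeasurableSet A →
    P {ω | X ω ∈ A ∧ ∀ s ∈ Finset.Icc 1 t, M s ω = m s} =
      ∫⁻ x in A, ENNReal.ofReal (historyProb d τ m t x) ∂(gaussianData μ σ)

/-! ### Test statistic, auxiliary statistics and p-value -/

/-- The product of an `n × n` matrix with the data matrix. -/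
def lmul {n p : ℕ} (A : Matrix (Fin n) (Fin n) ℝ) (x : Data n p) : Data n p :=
  fun i j => ∑ k, A i k * x k j

/-- The squared Frobenius norm. -/
def frobSq {n p : ℕ} (x : Data n p) : ℝ := ∑ i, ∑ j, x i j ^ 2

/-- The direction of a matrix: the matrix divided by its Frobenius norm. -/
def dir {n p : ℕ} (x : Data n p) : Data n p := (Real.sqrt (frobSq x))⁻¹ • x

/-- The indicator vector of a cluster. -/
def ind {n : ℕ} (C : Finset (Fin n)) : Fin n → ℝ := fun i => if i ∈ C then 1 else 0

/-- The contrast vector whose inner product with the data is the difference of cluster means. -/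
def contrast {n : ℕ} (M : Merge n) : Fin n → ℝ :=
  fun i => ind M.1 i / (M.1.card : ℝ) - ind M.2 i / (M.2.card : ℝ)

/-- The projection onto the span of the contrast vector. -/
def projB {n : ℕ} (M : Merge n) : Matrix (Fin n) (Fin n) ℝ :=
  (∑ i, contrast M i ^ 2)⁻¹ • Matrix.vecMulVec (contrast M) (contrast M)

/-- The projection that centers the rows of a cluster at the cluster mean and annihilates the
other rows. -/
def centering {n : ℕ} (C : Finset (Fin n)) : Matrix (Fin n) (Fin n) ℝ :=
  Matrix.diagonal (ind C) - (C.card : ℝ)⁻¹ • Matrix.vecMulVec (ind C) (ind C)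

/-- The projection onto the within-cluster differences of the two merged clusters. -/
def projW {n : ℕ} (M : Merge n) : Matrix (Fin n) (Fin n) ℝ := centering M.1 + centering M.2

/-- `|C₁| + |C₂| - 2` for the merge of `C₁` and `C₂`. -/
def dof {n : ℕ} (M : Merge n) : ℝ := (M.1.card : ℝ) + (M.2.card : ℝ) - 2

/-- The between-cluster sum of squares of a merge. -/
def bcss {n p : ℕ} (M : Merge n) (x : Data n p) : ℝ := frobSq (lmul (projB M) x)

/-- The within-cluster sum of squares of a merge. -/
def wcss {n p : ℕ} (M : Merge n) (x : Data n p) : ℝ := frobSq (lmul (projW M) x)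

/-- The test statistic. -/
def testStat {n p : ℕ} (M : Merge n) (x : Data n p) : ℝ := dof M * (bcss M x / wcss M x)

/-- The data matrix whose test statistic is `r` and whose auxiliary statistics (the directions of
`B x` and `W x`, the sum of their squared norms, and the residual `(I - B - W) x`) are those
of `x`. -/
def dataAt {n p : ℕ} (M : Merge n) (x : Data n p) (r : ℝ) : Data n p :=
  Real.sqrt (bcss M x + wcss M x) •
      (Real.sqrt (r / (dof M + r)) • dir (lmul (projB M) x) +
        Real.sqrt (dof M / (dof M + r)) • dir (lmul (projW M) x)) +
    lmul (1 - projB M - projW M) x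

/-- The density of the F distribution with `a` and `b` degrees of freedom. -/
def fDensity (a b r : ℝ) : ℝ :=
  if 0 < r then
    (a / b) ^ (a / 2) / ProbabilityTheory.beta (a / 2) (b / 2) * r ^ (a / 2 - 1) *
      (1 + a / b * r) ^ (-((a + b) / 2))
  else 0

/-- The unnormalized density at `r` of the null conditional distribution of the test statistic of
the merge `m t`, given the auxiliary statistics of `x` and the merges `m 1, …, m t`. -/
def condDensity {n p : ℕ} (d : Merge n → Data n p → ℝ) (τ : ℝ) (m : ℕ → Merge n) (t : ℕ)
    (x : Data n p) (r : ℝ) : ℝ :=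
  fDensity p (dof (m t) * p) r * historyProb d τ m t (dataAt (m t) x r)

/-- The null conditional distribution function of the test statistic of the merge `m t`. -/
def condCDF {n p : ℕ} (d : Merge n → Data n p → ℝ) (τ : ℝ) (m : ℕ → Merge n) (t : ℕ)
    (x : Data n p) (r : ℝ) : ℝ :=
  (∫ u in Set.Ioc 0 r, condDensity d τ m t x u) / ∫ u in Set.Ioi 0, condDensity d τ m t x u

/-- The p-value of the test, at step `t`, of the hypothesis that all observations in the two
merged clusters have the same mean: the null conditional probability that the test statistic is
at least its observed value. -/
def pValue {n p : ℕ} (d : Merge n → Data n p → ℝ) (τ : ℝ) (m : ℕ → Merge n) (t : ℕ)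
    (x : Data n p) : ℝ :=
  1 - condCDF d τ m t x (testStat (m t) x)

/-! ### Adaptive alpha-spending -/

/-- The size of the smaller of the two merged clusters. -/
def minSize {n : ℕ} (M : Merge n) : ℝ := ((min M.1.card M.2.card : ℕ) : ℝ)

/-- The test level chosen for a merge from the nonempty multiset `S` of unused levels: the
smallest one if the smaller cluster has at most `nStar` elements, the largest one otherwise. -/
def testLevel {n : ℕ} (nStar : ℝ) (S : Multiset ℝ) (M : Merge n) : ℝ :=
  if minSize M ≤ nStar then sInf {a | a ∈ S} else sSup {a | a ∈ S}

/-- The alpha-spending procedure, started at step `t` with the unused levels `S` and with `k` steps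
to go; it returns the estimated number of clusters. Merges whose smaller cluster has at most `nMin`
elements are not tested; the first rejection stops the procedure. -/
def spend {n p : ℕ} (d : Merge n → Data n p → ℝ) (τ nMin nStar : ℝ) (m : ℕ → Merge n)
    (x : Data n p) : (k t : ℕ) → (S : Multiset ℝ) → ℕ
  | 0, _, _ => 1
  | k + 1, t, S =>
    if minSize (m t) ≤ nMin then spend d τ nMin nStar m x k (t + 1) S
    else if pValue d τ m t x < testLevel nStar S (m t) then n - t + 1
    else spend d τ nMin nStar m x k (t + 1) (S.erase (testLevel nStar S (m t)))

/-- The estimated number of clusters: the procedure is run through the steps `1, …, n - 1` with the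
prescribed levels `a`. -/
def kHat {n p : ℕ} (d : Merge n → Data n p → ℝ) (τ nMin nStar : ℝ) (a : Fin (n - 1) → ℝ)
    (m : ℕ → Merge n) (x : Data n p) : ℕ :=
  spend d τ nMin nStar m x (n - 1) 1 (Finset.univ.val.map a)

/-- The true cluster structure, given by the labels `z`, is preserved: before step `n - K + 1`
every merge joins two clusters whose observations all belong to one true cluster. -/
def NoCrossMerge {n K : ℕ} (z : Fin n → Fin K) (m : ℕ → Merge n) : Prop :=
  ∀ t, 1 ≤ t → t < n - K + 1 →
    ∀ i ∈ (m t).1 ∪ (m t).2, ∀ j ∈ (m t).1 ∪ (m t).2, z i = z j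

end RandClust

end

/-! Fix a merge history up to step `t` whose last merge satisfies its null hypothesis. The mean is
then annihilated by the orthogonal projections `B` and `W`, so by Pythagoras the Gaussian density at
`x` depends on `B x` and `W x` only through `‖B x‖² + ‖W x‖²`. Hence the ratio statistic is
independent of the two directions, of the total length and of the residual, and it has an F law. In
place of a disintegration this is stated as an invariance: redrawing the ratio from the F density
along the path `r ↦ dataAt x r` leaves the Gaussian law unchanged
(`OrthProjPair.lintegral_resample`). It follows from polar coordinates on the ranges of `B` and `W`
(`lintegral_resample_ratio`).

Given the data, the history has probability `historyProb`. The invariance is applied to this weight,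
and to this weight restricted to `{pValue < u}`. Along a path the test statistic is `r` itself and
the path does not depend on its starting point, so the p-value is the normalized survival function
of `condDensity` at `r`. The probability integral transform on each path gives the conditional
validity `setLIntegral_pValue_lt_le`.

The level spent at a step is a function of the merges alone, so it is constant given the history.
Summing over the finitely many histories bounds the probability of rejecting a true null at a step
by the expected level spent there (`IsClusteringRun.measure_reject_le`). If `K̂ > K` and there was
no early cross-cluster merge, the rejection was made at a step whose null is true. A union bound
over the steps finishes the proof, since the levels spent along any history sum to at most `α`. No
independence between steps is needed. -/

noncomputable section

namespace RandClust

open Set Metric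

/-! ### Polar coordinates and the law of a ratio of lengths -/

section Radial

/-- Integration in polar coordinates with respect to an additive Haar measure. -/
lemma lintegral_eq_lintegral_toSphere {E : Type*} [NormedAddCommGroup E] [NormedSpace ℝ E]
    [MeasurableSpace E] [BorelSpace E] [FiniteDimensional ℝ E] [Nontrivial E]
    (μ : Measure E) [μ.IsAddHaarMeasure] {φ : E → ℝ≥0∞} (hφ : Measurable φ) :
    ∫⁻ x, φ x ∂μ = ∫⁻ u : sphere (0 : E) 1, (∫⁻ s in Ioi (0 : ℝ),
      ENNReal.ofReal (s ^ (Module.finrank ℝ E - 1)) * φ (s • (u : E))) ∂μ.toSphere := by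
  have key := (μ.measurePreserving_homeomorphUnitSphereProd).symm
    (homeomorphUnitSphereProd E).toMeasurableEquiv
  have h1 : ∫⁻ x, φ x ∂μ = ∫⁻ x : ({(0 : E)}ᶜ : Set E), φ x ∂(μ.comap (↑)) := by
    rw [lintegral_subtype_comap (measurableSet_singleton _).compl, restrict_compl_singleton]
  rw [h1, ← key.lintegral_comp (f := fun x : ({(0 : E)}ᶜ : Set E) => φ x)
    (hφ.comp measurable_subtype_coe), lintegral_prod]
  · refine lintegral_congr fun u => ?_
    rw [Measure.volumeIoiPow, lintegral_withDensity_eq_lintegral_mul]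
    · exact lintegral_subtype_comap measurableSet_Ioi
        (fun s : ℝ => ENNReal.ofReal (s ^ (Module.finrank ℝ E - 1)) * φ (s • (u : E)))
    · fun_prop
    · refine hφ.comp (measurable_subtype_coe.comp (key.measurable.comp ?_))
      exact measurable_prodMk_left
  · exact ((hφ.comp measurable_subtype_coe).comp key.measurable).aemeasurable

lemma lintegral_Ioi_comp_mul (φ : ℝ → ℝ≥0∞) {a : ℝ} (ha : 0 < a) :
    ∫⁻ s in Ioi (0 : ℝ), φ s = ENNReal.ofReal a * ∫⁻ s in Ioi (0 : ℝ), φ (a * s) := by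
  have h := lintegral_image_eq_lintegral_abs_deriv_mul (s := Ioi (0 : ℝ)) (f := fun s => a * s)
    (f' := fun _ => a) measurableSet_Ioi
    (fun x _ => by simpa using ((hasDerivAt_id x).const_mul a).hasDerivWithinAt)
    (fun x _ y _ h => mul_left_cancel₀ ha.ne' h) φ
  have hi : (fun s => a * s) '' Ioi (0 : ℝ) = Ioi 0 := by
    ext y
    simp only [mem_image, mem_Ioi]
    exact ⟨by rintro ⟨x, hx, rfl⟩; positivity, fun hy => ⟨y / a, by positivity, by field_simp⟩⟩
  rw [hi, lintegral_const_mul' _ _ ENNReal.ofReal_ne_top, abs_of_pos ha] at h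
  exact h

/-- Rescaling of the radial variable, used to pass from the unit sphere of the ambient norm to the
unit level set of a quadratic form. -/
lemma lintegral_Ioi_pow_comp_mul {p : ℕ} (hp : 1 ≤ p) (φ : ℝ → ℝ≥0∞) {a : ℝ} (ha : 0 < a) :
    ∫⁻ s in Ioi (0 : ℝ), ENNReal.ofReal (s ^ (p - 1)) * φ s = ENNReal.ofReal (a ^ p) *
      ∫⁻ s in Ioi (0 : ℝ), ENNReal.ofReal (s ^ (p - 1)) * φ (a * s) := by
  obtain ⟨p, rfl⟩ := Nat.exists_eq_add_of_le' hp
  rw [lintegral_Ioi_comp_mul _ ha, ← lintegral_const_mul' _ _ ENNReal.ofReal_ne_top,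
    ← lintegral_const_mul' _ _ ENNReal.ofReal_ne_top]
  refine setLIntegral_congr_fun measurableSet_Ioi fun s (hs : 0 < s) => ?_
  rw [← mul_assoc, ← mul_assoc, ← ENNReal.ofReal_mul (by positivity),
    ← ENNReal.ofReal_mul (by positivity)]
  congr 2
  simp only [Nat.add_sub_cancel]
  ring

lemma lintegral_Ioi_comp_sqrt (φ : ℝ → ℝ≥0∞) :
    ∫⁻ s in Ioi (0 : ℝ), φ s =
      ∫⁻ r in Ioi (0 : ℝ), ENNReal.ofReal (1 / (2 * √r)) * φ (√r) := by
  have h := lintegral_image_eq_lintegral_abs_deriv_mul (s := Ioi (0 : ℝ)) (f := Real.sqrt)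
    (f' := fun r => 1 / (2 * √r)) measurableSet_Ioi
    (fun x hx => (Real.hasDerivAt_sqrt (ne_of_gt hx)).hasDerivWithinAt)
    (fun x hx y hy h => (Real.sqrt_inj (le_of_lt hx) (le_of_lt hy)).1 h) φ
  have hi : Real.sqrt '' Ioi (0 : ℝ) = Ioi 0 := by
    ext y
    simp only [mem_image, mem_Ioi]
    exact ⟨by rintro ⟨x, hx, rfl⟩; positivity,
      fun hy => ⟨y ^ 2, by positivity, Real.sqrt_sq hy.le⟩⟩
  rw [hi] at h
  rw [h]
  refine setLIntegral_congr_fun measurableSet_Ioi fun r _ => ?_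
  rw [abs_of_nonneg (by positivity)]

/-- The kernel `r ^ (p / 2 - 1) * (1 + r / ν) ^ (-(p + q) / 2)` of the F density. -/
def fKernel (p q : ℕ) (ν r : ℝ) : ℝ :=
  r ^ ((p : ℝ) / 2 - 1) * (1 + r / ν) ^ (-(((p : ℝ) + q) / 2))

@[fun_prop]
lemma measurable_fKernel (p q : ℕ) (ν : ℝ) : Measurable (fKernel p q ν) := by
  unfold fKernel
  fun_prop

lemma fKernel_nonneg (p q : ℕ) {ν r : ℝ} (hν : 0 < ν) (hr : 0 < r) : 0 ≤ fKernel p q ν r := by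
  unfold fKernel
  positivity

/-- Integration over the quadrant in the coordinates `r = ν s² / t²`, `ρ² = s² + t²`. -/
lemma lintegral_quadrant {p q : ℕ} (hp : 1 ≤ p) (hq : 1 ≤ q) {ν : ℝ} (hν : 0 < ν) :
    ∃ A : ℝ≥0∞, ∀ k : ℝ → ℝ → ℝ≥0∞, Measurable (Function.uncurry k) →
      ∫⁻ s in Ioi (0 : ℝ), ENNReal.ofReal (s ^ (p - 1)) *
        ∫⁻ t in Ioi (0 : ℝ), ENNReal.ofReal (t ^ (q - 1)) * k s t =
      A * ∫⁻ r in Ioi (0 : ℝ), ENNReal.ofReal (fKernel p q ν r) *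
        ∫⁻ ρ in Ioi (0 : ℝ), ENNReal.ofReal (ρ ^ (p + q - 1)) *
          k (ρ * √(r / (ν + r))) (ρ * √(ν / (ν + r))) := by
  -- For fixed `t`, `s = t √(r/ν)` gives `s^(p-1) ds = ½ ν^(-p/2) t^p r^(p/2-1) dr`, whence the
  -- constant and the first factor of `fKernel`. For fixed `r`, `t = ρ √(ν/(ν+r))` then turns
  -- `t^(p+q-1) dt` into `(1 + r/ν)^(-(p+q)/2) ρ^(p+q-1) dρ`, the second factor.
  refine ⟨ENNReal.ofReal (1 / 2 * √(1 / ν) ^ p), fun k hk => ?_⟩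
  have hk2 : ∀ {f g : ℝ × ℝ → ℝ}, Measurable f → Measurable g →
      Measurable fun x => k (f x) (g x) := fun hf hg => hk.comp (hf.prodMk hg)
  calc _ = ∫⁻ s in Ioi (0 : ℝ), ∫⁻ t in Ioi (0 : ℝ),
        ENNReal.ofReal (s ^ (p - 1)) * (ENNReal.ofReal (t ^ (q - 1)) * k s t) := by
        refine lintegral_congr fun s => ?_
        rw [lintegral_const_mul' _ _ ENNReal.ofReal_ne_top]
    _ = ∫⁻ t in Ioi (0 : ℝ), ∫⁻ s in Ioi (0 : ℝ),
        ENNReal.ofReal (s ^ (p - 1)) * (ENNReal.ofReal (t ^ (q - 1)) * k s t) := by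
        rw [lintegral_lintegral_swap]
        have := hk2 (f := Prod.fst) (g := Prod.snd) (by fun_prop) (by fun_prop)
        refine Measurable.aemeasurable ?_
        simp only [Function.uncurry_def]
        fun_prop
    _ = ∫⁻ t in Ioi (0 : ℝ), ∫⁻ r in Ioi (0 : ℝ),
        ENNReal.ofReal (1 / 2 * √(1 / ν) ^ p * r ^ ((p : ℝ) / 2 - 1)) *
          (ENNReal.ofReal (t ^ (p + q - 1)) * k (t * √(r / ν)) t) := by
        refine setLIntegral_congr_fun measurableSet_Ioi fun t (ht : 0 < t) => ?_
        have hc : 0 < t * √(1 / ν) := by positivity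
        rw [lintegral_Ioi_comp_mul _ hc, lintegral_Ioi_comp_sqrt,
          ← lintegral_const_mul' _ _ ENNReal.ofReal_ne_top]
        refine setLIntegral_congr_fun measurableSet_Ioi fun r (hr : 0 < r) => ?_
        have e1 : t * √(1 / ν) * √r = t * √(r / ν) := by
          rw [mul_assoc, ← Real.sqrt_mul (by positivity), one_div_mul_eq_div]
        rw [e1, ← mul_assoc, ← mul_assoc, ← mul_assoc, ← mul_assoc,
          ← ENNReal.ofReal_mul (by positivity), ← ENNReal.ofReal_mul (by positivity),
          ← ENNReal.ofReal_mul (by positivity), ← ENNReal.ofReal_mul (by positivity), ← e1]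
        congr 2
        obtain ⟨p, rfl⟩ := Nat.exists_eq_add_of_le' hp
        obtain ⟨q, rfl⟩ := Nat.exists_eq_add_of_le' hq
        have e2 : r ^ (((p + 1 : ℕ) : ℝ) / 2 - 1) = √r ^ p / √r := by
          rw [Real.sqrt_eq_rpow, ← Real.rpow_natCast, ← Real.rpow_mul hr.le, ← Real.rpow_sub hr]
          congr 1
          push_cast
          ring
        have e3 : p + 1 + (q + 1) - 1 = p + 1 + q := by omega
        have hs : 0 < √r := by positivity
        rw [e2, e3]
        simp only [Nat.add_sub_cancel]
        field_simp
        ring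
    _ = ∫⁻ r in Ioi (0 : ℝ), ∫⁻ t in Ioi (0 : ℝ),
        ENNReal.ofReal (1 / 2 * √(1 / ν) ^ p * r ^ ((p : ℝ) / 2 - 1)) *
          (ENNReal.ofReal (t ^ (p + q - 1)) * k (t * √(r / ν)) t) := by
        rw [lintegral_lintegral_swap]
        have := hk2 (f := fun x : ℝ × ℝ => x.1 * √(x.2 / ν)) (g := Prod.fst)
          (by fun_prop) (by fun_prop)
        refine Measurable.aemeasurable ?_
        simp only [Function.uncurry_def]
        fun_prop
    _ = _ := by
        rw [← lintegral_const_mul' _ _ ENNReal.ofReal_ne_top]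
        refine setLIntegral_congr_fun measurableSet_Ioi fun r (hr : 0 < r) => ?_
        have hc : 0 < √(ν / (ν + r)) := by positivity
        rw [lintegral_Ioi_comp_mul _ hc, ← mul_assoc,
          ← lintegral_const_mul' _ _ ENNReal.ofReal_ne_top,
          ← ENNReal.ofReal_mul (by positivity),
          ← lintegral_const_mul' _ _ ENNReal.ofReal_ne_top]
        refine setLIntegral_congr_fun measurableSet_Ioi fun ρ (hρ : 0 < ρ) => ?_
        have e1 : √(ν / (ν + r)) * ρ * √(r / ν) = ρ * √(r / (ν + r)) := by
          rw [mul_comm (√(ν / (ν + r))), mul_assoc, ← Real.sqrt_mul (by positivity)]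
          congr 2
          field_simp
        rw [e1, mul_comm (√(ν / (ν + r))) ρ, ← mul_assoc, ← mul_assoc, ← mul_assoc,
          ← ENNReal.ofReal_mul (by positivity), ← ENNReal.ofReal_mul (by positivity),
          ← ENNReal.ofReal_mul (by have := fKernel_nonneg p q hν hr; positivity)]
        congr 2
        have e2 : √(ν / (ν + r)) ^ (p + q) = (1 + r / ν) ^ (-(((p : ℝ) + q) / 2)) := by
          have : ν / (ν + r) = (1 + r / ν)⁻¹ := by field_simp
          rw [this, Real.sqrt_eq_rpow, ← Real.rpow_natCast, ← Real.rpow_mul (by positivity),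
            Real.inv_rpow (by positivity), ← Real.rpow_neg (by positivity)]
          congr 1
          push_cast
          ring
        obtain ⟨m, hm⟩ : ∃ m, p + q = m + 1 := ⟨p + q - 1, by omega⟩
        rw [fKernel, ← e2, hm]
        simp only [Nat.add_sub_cancel]
        ring

/-- The kernel is dominated by `r^(p/2-1)` near `0` and by a multiple of `r^(-q/2-1)` at infinity.
-/
lemma integrableOn_fKernel {p q : ℕ} (hp : 1 ≤ p) (hq : 1 ≤ q) {ν : ℝ} (hν : 0 < ν) :
    IntegrableOn (fKernel p q ν) (Ioi 0) := by
  have hp' : (1 : ℝ) ≤ p := by exact_mod_cast hp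
  have hq' : (1 : ℝ) ≤ q := by exact_mod_cast hq
  rw [← Ioc_union_Ioi_eq_Ioi (zero_le_one (α := ℝ)), integrableOn_union]
  constructor
  · have h : IntegrableOn (fun r : ℝ => r ^ ((p : ℝ) / 2 - 1)) (Ioc 0 1) :=
      (intervalIntegral.intervalIntegrable_rpow' (by linarith)).1
    refine h.mono' (by fun_prop) ?_
    filter_upwards [ae_restrict_mem measurableSet_Ioc] with r hr
    have hr0 : 0 < r := hr.1
    rw [Real.norm_of_nonneg (fKernel_nonneg p q hν hr0)]
    refine mul_le_of_le_one_right (by positivity) ?_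
    exact Real.rpow_le_one_of_one_le_of_nonpos (by rw [le_add_iff_nonneg_right]; positivity)
      (by linarith)
  · have h : IntegrableOn (fun r : ℝ => r ^ (-(q : ℝ) / 2 - 1) *
        (ν⁻¹) ^ (-(((p : ℝ) + q) / 2))) (Ioi 1) :=
      (integrableOn_Ioi_rpow_of_lt (by linarith) one_pos).mul_const _
    refine h.mono' (by fun_prop) ?_
    filter_upwards [ae_restrict_mem measurableSet_Ioi] with r hr
    have hr0 : 0 < r := lt_trans one_pos hr
    rw [Real.norm_of_nonneg (fKernel_nonneg p q hν hr0), fKernel]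
    have e : r ^ (-(q : ℝ) / 2 - 1) * (ν⁻¹) ^ (-(((p : ℝ) + q) / 2)) =
        r ^ ((p : ℝ) / 2 - 1) * (r / ν) ^ (-(((p : ℝ) + q) / 2)) := by
      rw [div_eq_mul_inv r ν, Real.mul_rpow hr0.le (by positivity), ← mul_assoc,
        ← Real.rpow_add hr0]
      congr 2
      ring
    rw [e]
    refine mul_le_mul_of_nonneg_left ?_ (by positivity)
    exact Real.rpow_le_rpow_of_nonpos (by positivity) (by linarith) (by linarith)

/-- Replacing the ratio of the lengths of two components by a random ratio with density `fKernel`,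
while their directions and total length are kept, preserves radially weighted Haar measure
up to normalization. -/
lemma lintegral_resample_ratio {E F : Type*} [NormedAddCommGroup E] [NormedSpace ℝ E]
    [MeasurableSpace E] [BorelSpace E] [FiniteDimensional ℝ E] [Nontrivial E]
    [NormedAddCommGroup F] [NormedSpace ℝ F]
    [MeasurableSpace F] [BorelSpace F] [FiniteDimensional ℝ F] [Nontrivial F]
    (μE : Measure E) [μE.IsAddHaarMeasure] (μF : Measure F) [μF.IsAddHaarMeasure]
    {QE : E → ℝ} (hQE : Measurable QE) (hQEs : ∀ (s : ℝ) b, QE (s • b) = s ^ 2 * QE b)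
    (hQEp : ∀ b, b ≠ 0 → 0 < QE b)
    {QF : F → ℝ} (hQF : Measurable QF) (hQFs : ∀ (s : ℝ) b, QF (s • b) = s ^ 2 * QF b)
    (hQFp : ∀ b, b ≠ 0 → 0 < QF b)
    {ν : ℝ} (hν : 0 < ν) {ψ : ℝ → ℝ≥0∞} (hψ : Measurable ψ)
    {K : E × F → ℝ≥0∞} (hK : Measurable K) :
    ∫⁻ b, (∫⁻ w, (ψ (√(QE b + QF w)) * ∫⁻ r in Ioi (0 : ℝ),
      ENNReal.ofReal (fKernel (Module.finrank ℝ E) (Module.finrank ℝ F) ν r) *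
        K (√(QE b + QF w) • √(r / (ν + r)) • (√(QE b))⁻¹ • b,
          √(QE b + QF w) • √(ν / (ν + r)) • (√(QF w))⁻¹ • w)) ∂μF) ∂μE =
    (∫⁻ r in Ioi (0 : ℝ),
      ENNReal.ofReal (fKernel (Module.finrank ℝ E) (Module.finrank ℝ F) ν r)) *
      ∫⁻ b, ∫⁻ w, ψ (√(QE b + QF w)) * K (b, w) ∂μF ∂μE := by
  set p := Module.finrank ℝ E with hpdef
  set q := Module.finrank ℝ F with hqdef
  have hp : 1 ≤ p := Module.finrank_pos
  have hq : 1 ≤ q := Module.finrank_pos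
  set C := ∫⁻ r in Ioi (0 : ℝ), ENNReal.ofReal (fKernel p q ν r) with hC
  obtain ⟨A, hA⟩ := lintegral_quadrant hp hq hν
  have polar : ∀ H : E × F → ℝ≥0∞, Measurable H →
      ∫⁻ b, ∫⁻ w, H (b, w) ∂μF ∂μE = ∫⁻ u : sphere (0 : E) 1, (∫⁻ v : sphere (0 : F) 1,
        (∫⁻ s in Ioi (0 : ℝ), ENNReal.ofReal (s ^ (p - 1)) * ∫⁻ t in Ioi (0 : ℝ),
          ENNReal.ofReal (t ^ (q - 1)) * H (s • (u : E), t • (v : F))) ∂μF.toSphere)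
          ∂μE.toSphere := by
    intro H hH
    rw [lintegral_eq_lintegral_toSphere μE hH.lintegral_prod_right']
    refine lintegral_congr fun u => ?_
    have h1 : ∀ s : ℝ, ENNReal.ofReal (s ^ (p - 1)) * ∫⁻ w, H (s • (u : E), w) ∂μF =
        ∫⁻ v : sphere (0 : F) 1, (ENNReal.ofReal (s ^ (p - 1)) * ∫⁻ t in Ioi (0 : ℝ),
          ENNReal.ofReal (t ^ (q - 1)) * H (s • (u : E), t • (v : F))) ∂μF.toSphere := by
      intro s
      rw [lintegral_eq_lintegral_toSphere μF
        (φ := fun w => H (s • (u : E), w)) (hH.comp measurable_prodMk_left),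
        ← lintegral_const_mul' _ _ ENNReal.ofReal_ne_top]
    rw [lintegral_congr h1, lintegral_lintegral_swap]
    refine Measurable.aemeasurable ?_
    refine Measurable.mul (by fun_prop) ?_
    refine Measurable.lintegral_prod_right'
      (f := fun x : (ℝ × sphere (0 : F) 1) × ℝ =>
        ENNReal.ofReal (x.2 ^ (q - 1)) * H (x.1.1 • (u : E), x.2 • (x.1.2 : F))) ?_
    exact Measurable.mul (by fun_prop) (hH.comp (by fun_prop))
  have hT : Measurable fun x : (E × F) × ℝ => ENNReal.ofReal (fKernel p q ν x.2) *
      K (√(QE x.1.1 + QF x.1.2) • √(x.2 / (ν + x.2)) • (√(QE x.1.1))⁻¹ • x.1.1,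
          √(QE x.1.1 + QF x.1.2) • √(ν / (ν + x.2)) • (√(QF x.1.2))⁻¹ • x.1.2) :=
    Measurable.mul (by fun_prop) (hK.comp (by fun_prop))
  have hH1 : Measurable fun x : E × F => ψ (√(QE x.1 + QF x.2)) * ∫⁻ r in Ioi (0 : ℝ),
      ENNReal.ofReal (fKernel p q ν r) *
        K (√(QE x.1 + QF x.2) • √(r / (ν + r)) • (√(QE x.1))⁻¹ • x.1,
          √(QE x.1 + QF x.2) • √(ν / (ν + r)) • (√(QF x.2))⁻¹ • x.2) :=
    Measurable.mul (by fun_prop) hT.lintegral_prod_right'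
  have hH2 : Measurable fun x : E × F => ψ (√(QE x.1 + QF x.2)) * K x :=
    Measurable.mul (by fun_prop) hK
  have hCtop : C ≠ ∞ := by
    exact (lintegral_ofReal_le_lintegral_enorm _).trans_lt (integrableOn_fKernel hp hq hν).2 |>.ne
  rw [polar _ hH1, polar _ hH2, ← lintegral_const_mul' _ _ hCtop]
  refine lintegral_congr fun u => ?_
  rw [← lintegral_const_mul' _ _ hCtop]
  refine lintegral_congr fun v => ?_
  have hu : (u : E) ≠ 0 := ne_zero_of_mem_unit_sphere u
  have hv : (v : F) ≠ 0 := ne_zero_of_mem_unit_sphere v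
  have hQu := hQEp _ hu
  have hQv := hQFp _ hv
  set a := (√(QE u))⁻¹ with ha
  set c := (√(QF v))⁻¹ with hc
  have ha0 : 0 < a := by positivity
  have hc0 : 0 < c := by positivity
  have hQa : QE (a • (u : E)) = 1 := by
    rw [hQEs, ha, inv_pow, Real.sq_sqrt hQu.le, inv_mul_cancel₀ hQu.ne']
  have hQc : QF (c • (v : F)) = 1 := by
    rw [hQFs, hc, inv_pow, Real.sq_sqrt hQv.le, inv_mul_cancel₀ hQv.ne']
  -- The norms of `E` and `F` are unrelated to `QE` and `QF` (for data matrices the ambient norm is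
  -- a sup norm). Each ray is rescaled by `a` or `c` to have unit quadratic length, after which
  -- `lintegral_quadrant` applies; the factors `a ^ p` and `c ^ q` are common to both sides.
  have quad : ∀ H : E × F → ℝ≥0∞, Measurable H →
      (∫⁻ s in Ioi (0 : ℝ), ENNReal.ofReal (s ^ (p - 1)) * ∫⁻ t in Ioi (0 : ℝ),
          ENNReal.ofReal (t ^ (q - 1)) * H (s • (u : E), t • (v : F))) =
      ENNReal.ofReal (a ^ p) * (ENNReal.ofReal (c ^ q) * (A *
        ∫⁻ r in Ioi (0 : ℝ), ENNReal.ofReal (fKernel p q ν r) *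
        ∫⁻ ρ in Ioi (0 : ℝ), ENNReal.ofReal (ρ ^ (p + q - 1)) *
          H ((ρ * √(r / (ν + r))) • a • (u : E), (ρ * √(ν / (ν + r))) • c • (v : F)))) := by
    intro H hH
    rw [lintegral_Ioi_pow_comp_mul hp _ ha0, ← hA (fun s t => H (s • a • (u : E), t • c • (v : F)))
      (hH.comp (by fun_prop)), ← lintegral_const_mul' (ENNReal.ofReal (c ^ q)) _
      ENNReal.ofReal_ne_top]
    congr 1
    refine lintegral_congr fun s => ?_
    rw [lintegral_Ioi_pow_comp_mul hq _ hc0]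
    simp only [smul_smul, mul_comm a, mul_comm c]
    ring
  rw [quad _ hH1, quad _ hH2]
  rw [mul_left_comm C, mul_left_comm C, mul_left_comm C]
  congr 3
  have hS : ∀ r ρ : ℝ, 0 < r → 0 < ρ → √(QE ((ρ * √(r / (ν + r))) • a • (u : E)) +
      QF ((ρ * √(ν / (ν + r))) • c • (v : F))) = ρ := by
    intro r ρ hr hρ
    rw [hQEs, hQFs, hQa, hQc, mul_pow, mul_pow, Real.sq_sqrt (by positivity),
      Real.sq_sqrt (by positivity)]
    have : ρ ^ 2 * (r / (ν + r)) * 1 + ρ ^ 2 * (ν / (ν + r)) * 1 = ρ ^ 2 := by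
      field_simp
      ring
    rw [this, Real.sqrt_sq hρ.le]
  have hdE : ∀ s : ℝ, 0 < s → (√(QE (s • a • (u : E))))⁻¹ • s • a • (u : E) = a • (u : E) := by
    intro s hs
    rw [hQEs, hQa, mul_one, Real.sqrt_sq hs.le, smul_smul, inv_mul_cancel₀ hs.ne', one_smul]
  have hdF : ∀ s : ℝ, 0 < s → (√(QF (s • c • (v : F))))⁻¹ • s • c • (v : F) = c • (v : F) := by
    intro s hs
    rw [hQFs, hQc, mul_one, Real.sqrt_sq hs.le, smul_smul, inv_mul_cancel₀ hs.ne', one_smul]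
  -- The resampled point forgets the original ratio `r`: the inner integrand depends only on `ρ` and
  -- the new ratio `r'`. So `r` survives only in its own kernel, which integrates to `C`.
  have hL : ∀ r ∈ Ioi (0 : ℝ), ENNReal.ofReal (fKernel p q ν r) *
      (∫⁻ ρ in Ioi (0 : ℝ), ENNReal.ofReal (ρ ^ (p + q - 1)) *
        (ψ (√(QE ((ρ * √(r / (ν + r))) • a • (u : E)) +
          QF ((ρ * √(ν / (ν + r))) • c • (v : F)))) * ∫⁻ r' in Ioi (0 : ℝ),
        ENNReal.ofReal (fKernel p q ν r') *
        K (√(QE ((ρ * √(r / (ν + r))) • a • (u : E)) +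
          QF ((ρ * √(ν / (ν + r))) • c • (v : F))) • √(r' / (ν + r')) •
            (√(QE ((ρ * √(r / (ν + r))) • a • (u : E))))⁻¹ • (ρ * √(r / (ν + r))) • a • (u : E),
          √(QE ((ρ * √(r / (ν + r))) • a • (u : E)) +
          QF ((ρ * √(ν / (ν + r))) • c • (v : F))) • √(ν / (ν + r')) •
            (√(QF ((ρ * √(ν / (ν + r))) • c • (v : F))))⁻¹ •
              (ρ * √(ν / (ν + r))) • c • (v : F)))) =
      ENNReal.ofReal (fKernel p q ν r) * ∫⁻ r' in Ioi (0 : ℝ),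
        ENNReal.ofReal (fKernel p q ν r') *
        ∫⁻ ρ in Ioi (0 : ℝ), ENNReal.ofReal (ρ ^ (p + q - 1)) *
        (ψ ρ * K ((ρ * √(r' / (ν + r'))) • a • (u : E), (ρ * √(ν / (ν + r'))) • c • (v : F))) := by
    intro r (hr : 0 < r)
    congr 1
    calc _ = ∫⁻ ρ in Ioi (0 : ℝ), ∫⁻ r' in Ioi (0 : ℝ), ENNReal.ofReal (fKernel p q ν r') *
        (ENNReal.ofReal (ρ ^ (p + q - 1)) * (ψ ρ * K ((ρ * √(r' / (ν + r'))) • a • (u : E),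
          (ρ * √(ν / (ν + r'))) • c • (v : F)))) := by
          refine setLIntegral_congr_fun measurableSet_Ioi fun ρ (hρ : 0 < ρ) => ?_
          rw [hS r ρ hr hρ, hdE _ (by positivity), hdF _ (by positivity), ← mul_assoc,
            ← lintegral_const_mul]
          · refine lintegral_congr fun r' => ?_
            simp only [smul_smul, mul_assoc]
            ring
          · exact Measurable.mul (by fun_prop) (hK.comp (by fun_prop))
      _ = _ := by
          rw [lintegral_lintegral_swap]
          · refine lintegral_congr fun r' => ?_
            rw [lintegral_const_mul' _ _ ENNReal.ofReal_ne_top]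
          · refine Measurable.aemeasurable ?_
            refine Measurable.mul (by fun_prop) (Measurable.mul (by fun_prop)
              (Measurable.mul (by fun_prop) (hK.comp (by fun_prop))))
  rw [setLIntegral_congr_fun measurableSet_Ioi hL, lintegral_mul_const _ (by fun_prop)]
  congr 1
  refine setLIntegral_congr_fun measurableSet_Ioi fun r (hr : 0 < r) => ?_
  simp only
  congr 1
  refine setLIntegral_congr_fun measurableSet_Ioi fun ρ (hρ : 0 < ρ) => ?_
  rw [hS r ρ hr hρ]

end Radial

/-! ### The Gaussian density of a data matrix -/

section Density

lemma pi_withDensity_ofReal {ι : Type*} [Fintype ι] {α : ι → Type*} [∀ i, MeasurableSpace (α i)]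
    (μ : ∀ i, Measure (α i)) [∀ i, SigmaFinite (μ i)] (f : ∀ i, α i → ℝ) (hf0 : ∀ i x, 0 ≤ f i x)
    (hf : ∀ i, Integrable (f i) (μ i)) :
    Measure.pi (fun i => (μ i).withDensity fun x => ENNReal.ofReal (f i x)) =
      (Measure.pi μ).withDensity fun x => ENNReal.ofReal (∏ i, f i (x i)) := by
  have : ∀ i, SigmaFinite ((μ i).withDensity fun x => ENNReal.ofReal (f i x)) := fun i =>
    SigmaFinite.withDensity_of_ne_top (by simp)
  refine Measure.pi_eq fun s hs => ?_
  rw [withDensity_apply _ (MeasurableSet.univ_pi hs), Measure.restrict_pi_pi,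
    ← ofReal_integral_eq_lintegral_ofReal, integral_fintype_prod_eq_prod,
    ENNReal.ofReal_prod_of_nonneg (fun i _ => integral_nonneg (hf0 i))]
  · refine Finset.prod_congr rfl fun i _ => ?_
    rw [withDensity_apply _ (hs i), ← ofReal_integral_eq_lintegral_ofReal (hf i).integrableOn
      (Filter.Eventually.of_forall (hf0 i))]
  · exact Integrable.fintype_prod_dep fun i => (hf i).integrableOn
  · exact Filter.Eventually.of_forall fun x => Finset.prod_nonneg fun i _ => hf0 i _

lemma gaussianData_eq_withDensity {n p : ℕ} (μ : Data n p) {σ : ℝ≥0} (hσ : 0 < σ) :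
    ∃ k : ℝ, 0 < k ∧ gaussianData μ σ = (volume : Measure (Data n p)).withDensity fun x =>
      ENNReal.ofReal (k * Real.exp (-(frobSq (x - μ)) / (2 * σ ^ 2))) := by
  have hv : (σ ^ 2 : ℝ≥0) ≠ 0 := by positivity
  have hg : ∀ (m x : ℝ), 0 ≤ ProbabilityTheory.gaussianPDFReal m (σ ^ 2) x := fun m x =>
    ProbabilityTheory.gaussianPDFReal_nonneg _ _ _
  refine ⟨∏ _i : Fin n, ∏ _j : Fin p, (√(2 * Real.pi * (σ ^ 2 : ℝ≥0)))⁻¹, ?_, ?_⟩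
  · refine Finset.prod_pos fun i _ => Finset.prod_pos fun j _ => ?_
    have : (0 : ℝ) < (σ ^ 2 : ℝ≥0) := by positivity
    positivity
  · unfold gaussianData
    have h1 : ∀ i, (Measure.pi fun j => ProbabilityTheory.gaussianReal (μ i j) (σ ^ 2)) =
        (Measure.pi fun _ : Fin p => (volume : Measure ℝ)).withDensity fun y : Fin p → ℝ =>
          ENNReal.ofReal (∏ j, ProbabilityTheory.gaussianPDFReal (μ i j) (σ ^ 2) (y j)) := by
      intro i
      rw [← pi_withDensity_ofReal _ _ (fun j => hg _)
        fun j => ProbabilityTheory.integrable_gaussianPDFReal _ _]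
      congr 1
      funext j
      rw [ProbabilityTheory.gaussianReal_of_var_ne_zero _ hv]
      rfl
    simp_rw [h1]
    rw [pi_withDensity_ofReal (fun _ : Fin n => Measure.pi fun _ : Fin p => (volume : Measure ℝ))
      (fun i y => ∏ j, ProbabilityTheory.gaussianPDFReal (μ i j) (σ ^ 2) (y j))
      (fun i y => Finset.prod_nonneg fun j _ => hg _ _)
      fun i => Integrable.fintype_prod fun j =>
        ProbabilityTheory.integrable_gaussianPDFReal _ _]
    congr 1
    funext x
    congr 1
    simp only [ProbabilityTheory.gaussianPDFReal_def, Finset.prod_mul_distrib, ← Real.exp_sum]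
    congr 2
    simp only [frobSq, Pi.sub_apply, ← Finset.sum_div, Finset.sum_neg_distrib]
    push_cast
    rfl

end Density

/-! ### Data matrices as a vector space: left multiplication and the Frobenius norm -/

section LinearAlgebra

variable {n p : ℕ}

/-- Left multiplication of data matrices by a fixed matrix, as a linear map. -/
def lmulLin (p : ℕ) (A : Matrix (Fin n) (Fin n) ℝ) : Data n p →ₗ[ℝ] Data n p where
  toFun := lmul A
  map_add' x y := by
    funext i j
    simp [lmul, mul_add, Finset.sum_add_distrib]
  map_smul' c x := by
    funext i j
    simp [lmul, Finset.mul_sum, mul_left_comm]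

@[simp]
lemma lmulLin_apply (A : Matrix (Fin n) (Fin n) ℝ) (x : Data n p) :
    lmulLin p A x = lmul A x := rfl

lemma of_lmul (A : Matrix (Fin n) (Fin n) ℝ) (x : Data n p) :
    Matrix.of (lmul A x) = A * Matrix.of x := by
  ext i j
  simp [lmul, Matrix.mul_apply]

lemma lmul_lmul (A A' : Matrix (Fin n) (Fin n) ℝ) (x : Data n p) :
    lmul A (lmul A' x) = lmul (A * A') x := by
  apply Matrix.of.injective
  simp only [of_lmul, Matrix.mul_assoc]

lemma lmul_add (A : Matrix (Fin n) (Fin n) ℝ) (x y : Data n p) :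
    lmul A (x + y) = lmul A x + lmul A y := (lmulLin p A).map_add x y

lemma lmul_sub (A : Matrix (Fin n) (Fin n) ℝ) (x y : Data n p) :
    lmul A (x - y) = lmul A x - lmul A y := (lmulLin p A).map_sub x y

lemma lmul_smul (A : Matrix (Fin n) (Fin n) ℝ) (c : ℝ) (x : Data n p) :
    lmul A (c • x) = c • lmul A x := (lmulLin p A).map_smul c x

@[simp]
lemma lmul_zero (A : Matrix (Fin n) (Fin n) ℝ) : lmul A (0 : Data n p) = 0 :=
  (lmulLin p A).map_zero

@[simp]
lemma zero_lmul (x : Data n p) : lmul (0 : Matrix (Fin n) (Fin n) ℝ) x = 0 := by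
  funext i j
  simp [lmul]

lemma sub_lmul (A A' : Matrix (Fin n) (Fin n) ℝ) (x : Data n p) :
    lmul (A - A') x = lmul A x - lmul A' x := by
  funext i j
  simp [lmul, sub_mul]

@[simp]
lemma one_lmul (x : Data n p) : lmul (1 : Matrix (Fin n) (Fin n) ℝ) x = x := by
  funext i j
  simp [lmul, Matrix.one_apply]

@[fun_prop]
lemma measurable_lmul (A : Matrix (Fin n) (Fin n) ℝ) :
    Measurable (lmul A : Data n p → Data n p) :=
  (LinearMap.continuous_of_finiteDimensional (lmulLin p A)).measurable

@[fun_prop]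
lemma measurable_frobSq : Measurable (frobSq : Data n p → ℝ) := by
  unfold frobSq
  fun_prop

lemma frobSq_nonneg (x : Data n p) : 0 ≤ frobSq x :=
  Finset.sum_nonneg fun _ _ => Finset.sum_nonneg fun _ _ => sq_nonneg _

lemma frobSq_smul (c : ℝ) (x : Data n p) : frobSq (c • x) = c ^ 2 * frobSq x := by
  simp [frobSq, mul_pow, Finset.mul_sum]

lemma frobSq_pos {x : Data n p} (hx : x ≠ 0) : 0 < frobSq x := by
  refine lt_of_le_of_ne (frobSq_nonneg x) fun h => hx ?_
  funext i j
  have h1 := (Finset.sum_eq_zero_iff_of_nonneg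
    (fun i _ => Finset.sum_nonneg fun j _ => sq_nonneg (x i j))).1 h.symm i (Finset.mem_univ _)
  have h2 := (Finset.sum_eq_zero_iff_of_nonneg (fun j _ => sq_nonneg (x i j))).1 h1 j
    (Finset.mem_univ _)
  simpa using h2

@[fun_prop]
lemma measurable_dir : Measurable (dir : Data n p → Data n p) := by
  unfold dir
  fun_prop

/-- Data matrices with orthogonal column spaces add in squared Frobenius norm. -/
lemma frobSq_add_of_transpose_mul {x y : Data n p}
    (h : (Matrix.of x).transpose * Matrix.of y = 0) : frobSq (x + y) = frobSq x + frobSq y := by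
  have hs : ∑ i, ∑ j, x i j * y i j = 0 := by
    rw [Finset.sum_comm]
    refine Finset.sum_eq_zero fun j _ => ?_
    simpa [Matrix.mul_apply] using congrFun (congrFun h j) j
  have : frobSq (x + y) = frobSq x + frobSq y + 2 * ∑ i, ∑ j, x i j * y i j := by
    simp only [frobSq, Pi.add_apply, Finset.mul_sum, ← Finset.sum_add_distrib]
    refine Finset.sum_congr rfl fun i _ => Finset.sum_congr rfl fun j _ => ?_
    ring
  rw [this, hs, mul_zero, add_zero]

lemma transpose_mul_eq_zero {A : Matrix (Fin n) (Fin n) ℝ} (hA : A.transpose = A)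
    {x y : Data n p} (hx : lmul A x = x) (hy : lmul A y = 0) :
    (Matrix.of x).transpose * Matrix.of y = 0 := by
  have hx' : Matrix.of x = A * Matrix.of x := by rw [← of_lmul, hx]
  have hy' : A * Matrix.of y = 0 := by
    rw [← of_lmul, hy]
    rfl
  rw [hx', Matrix.transpose_mul, hA, Matrix.mul_assoc, hy', Matrix.mul_zero]

/-- The matrix acts separately on each of the `p` columns. -/
lemma trace_lmulLin (A : Matrix (Fin n) (Fin n) ℝ) :
    LinearMap.trace ℝ (Data n p) (lmulLin p A) = p * A.trace := by
  rw [LinearMap.trace_eq_matrix_trace ℝ (Pi.basis fun _ : Fin n => Pi.basisFun ℝ (Fin p)),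
    Matrix.trace, Fintype.sum_sigma]
  simp only [Matrix.diag_apply, LinearMap.toMatrix_apply, Pi.basis_repr, Pi.basis_apply,
    Pi.basisFun_apply, Pi.basisFun_repr, lmulLin_apply, lmul]
  simp [Pi.single_apply, Matrix.trace, Finset.mul_sum, ite_apply]

/-- The rank of an idempotent is its trace. This supplies the degrees of freedom without a choice of
bases. -/
lemma finrank_range_lmulLin {A : Matrix (Fin n) (Fin n) ℝ} (hA : A * A = A) :
    (Module.finrank ℝ (LinearMap.range (lmulLin p A)) : ℝ) = p * A.trace := by
  rw [← trace_lmulLin, LinearMap.IsProj.trace (p := LinearMap.range (lmulLin p A))]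
  constructor
  · exact fun x => LinearMap.mem_range_self _ x
  · rintro _ ⟨y, rfl⟩
    simp [lmul_lmul, hA]

end LinearAlgebra

/-! ### Invariance of the Gaussian law under resampling of the ratio -/

section Resample

variable {n p : ℕ}

/-- The data matrix whose components along two complementary projections `B` and `W` are rescaled
to have ratio of squared lengths `r / ν`, the directions and the total length being kept. -/
def resample (B W : Matrix (Fin n) (Fin n) ℝ) (ν : ℝ) (x : Data n p) (r : ℝ) : Data n p :=
  √(frobSq (lmul B x) + frobSq (lmul W x)) •
      (√(r / (ν + r)) • dir (lmul B x) + √(ν / (ν + r)) • dir (lmul W x)) +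
    lmul (1 - B - W) x

@[fun_prop]
lemma measurable_resample (B W : Matrix (Fin n) (Fin n) ℝ) (ν : ℝ) :
    Measurable fun x : Data n p × ℝ => resample B W ν x.1 x.2 := by
  unfold resample
  fun_prop

/-- A pair of orthogonal projections with orthogonal ranges. -/
structure OrthProjPair (B W : Matrix (Fin n) (Fin n) ℝ) : Prop where
  transpose_left : B.transpose = B
  transpose_right : W.transpose = W
  mul_self_left : B * B = B
  mul_self_right : W * W = W
  mul_left_right : B * W = 0
  mul_right_left : W * B = 0

variable {B W : Matrix (Fin n) (Fin n) ℝ}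

lemma OrthProjPair.lmul_left_sum (h : OrthProjPair B W) {b w c : Data n p}
    (hb : lmul B b = b) (hw : lmul W w = w) (hcB : lmul B c = 0) :
    lmul B (c + (b + w)) = b := by
  rw [lmul_add, lmul_add, hb, hcB, ← hw, lmul_lmul, h.mul_left_right]
  simp

lemma OrthProjPair.lmul_right_sum (h : OrthProjPair B W) {b w c : Data n p}
    (hb : lmul B b = b) (hw : lmul W w = w) (hcW : lmul W c = 0) :
    lmul W (c + (b + w)) = w := by
  rw [lmul_add, lmul_add, hw, hcW, ← hb, lmul_lmul, h.mul_right_left]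
  simp

lemma OrthProjPair.lmul_compl_sum (h : OrthProjPair B W) {b w c : Data n p}
    (hb : lmul B b = b) (hw : lmul W w = w) (hcB : lmul B c = 0) (hcW : lmul W c = 0) :
    lmul (1 - B - W) (c + (b + w)) = c := by
  rw [sub_lmul, sub_lmul, one_lmul, h.lmul_left_sum hb hw hcB, h.lmul_right_sum hb hw hcW]
  abel

lemma OrthProjPair.frobSq_sum (h : OrthProjPair B W) {b w c : Data n p}
    (hb : lmul B b = b) (hw : lmul W w = w) (hcB : lmul B c = 0) (hcW : lmul W c = 0) :
    frobSq (c + (b + w)) = frobSq b + frobSq w + frobSq c := by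
  have hBw : lmul B w = 0 := by rw [← hw, lmul_lmul, h.mul_left_right, zero_lmul]
  rw [add_comm c, add_assoc, frobSq_add_of_transpose_mul, frobSq_add_of_transpose_mul, add_assoc]
  · exact transpose_mul_eq_zero h.transpose_right hw hcW
  · exact transpose_mul_eq_zero h.transpose_left hb (by rw [lmul_add, hBw, hcB, add_zero])

lemma lmul_dir (A : Matrix (Fin n) (Fin n) ℝ) (hA : A * A = A) (x : Data n p) :
    lmul A (dir (lmul A x)) = dir (lmul A x) := by
  rw [dir, lmul_smul, lmul_lmul, hA]

lemma OrthProjPair.lmul_left_compl (h : OrthProjPair B W) (x : Data n p) :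
    lmul B (lmul (1 - B - W) x) = 0 := by
  rw [lmul_lmul, mul_sub, mul_sub, mul_one, h.mul_self_left, h.mul_left_right]
  simp

lemma OrthProjPair.lmul_right_compl (h : OrthProjPair B W) (x : Data n p) :
    lmul W (lmul (1 - B - W) x) = 0 := by
  rw [lmul_lmul, mul_sub, mul_sub, mul_one, h.mul_self_right, h.mul_right_left]
  simp

/-- The decomposition of the space of data matrices along two complementary projections. -/
lemma OrthProjPair.exists_decomposition (h : OrthProjPair B W) :
    ∃ Φ : ((LinearMap.ker (lmulLin p B) ⊓ LinearMap.ker (lmulLin p W) :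
        Submodule ℝ (Data n p)) × LinearMap.range (lmulLin p B) × LinearMap.range (lmulLin p W))
        ≃L[ℝ] Data n p, ∀ c b w, Φ (c, b, w) = (c : Data n p) + ((b : Data n p) + w) := by
  have hB : ∀ b : LinearMap.range (lmulLin p B), lmul B (b : Data n p) = b := by
    rintro ⟨_, x, rfl⟩
    simp [lmul_lmul, h.mul_self_left]
  have hW : ∀ b : LinearMap.range (lmulLin p W), lmul W (b : Data n p) = b := by
    rintro ⟨_, x, rfl⟩
    simp [lmul_lmul, h.mul_self_right]
  let f := (Submodule.subtype (LinearMap.ker (lmulLin p B) ⊓ LinearMap.ker (lmulLin p W))).coprod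
    ((Submodule.subtype (LinearMap.range (lmulLin p B))).coprod
      (Submodule.subtype (LinearMap.range (lmulLin p W))))
  have hf : Function.Bijective f := by
    constructor
    · rw [← LinearMap.ker_eq_bot, LinearMap.ker_eq_bot']
      rintro ⟨⟨c, hcB, hcW⟩, b, w⟩ hx
      have hx' : c + ((b : Data n p) + w) = 0 := hx
      have h1 := h.lmul_left_sum (hB b) (hW w) hcB
      have h2 := h.lmul_right_sum (hB b) (hW w) hcW
      have h3 := h.lmul_compl_sum (hB b) (hW w) hcB hcW
      rw [hx', lmul_zero] at h1 h2 h3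
      simp only [Prod.mk_eq_zero]
      exact ⟨Subtype.ext h3.symm, Subtype.ext h1.symm, Subtype.ext h2.symm⟩
    · intro x
      refine ⟨(⟨lmul (1 - B - W) x, h.lmul_left_compl x, h.lmul_right_compl x⟩,
        ⟨lmul B x, x, rfl⟩, ⟨lmul W x, x, rfl⟩), ?_⟩
      simp only [f, LinearMap.coprod_apply, Submodule.subtype_apply, sub_lmul, one_lmul]
      abel
  exact ⟨(LinearEquiv.ofBijective f hf).toContinuousLinearEquiv, fun c b w => rfl⟩

/-- Under a Gaussian law whose mean is annihilated by both projections, the ratio of the squared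
lengths of the two components is independent of their directions, of the total length and of the
residual, and has density proportional to `fKernel`. -/
lemma OrthProjPair.lintegral_resample (h : OrthProjPair B W) (hp : 1 ≤ p) (hBt : B.trace = 1)
    {ν : ℝ} (hν : 0 < ν) (hWt : W.trace = ν) {q : ℕ} (hq : (q : ℝ) = ν * p) {μ : Data n p} (hμB : lmul B μ = 0)
    (hμW : lmul W μ = 0) {σ : ℝ≥0} (hσ : 0 < σ) {G : Data n p → ℝ≥0∞} (hG : Measurable G) :
    ∫⁻ x, (∫⁻ r in Ioi (0 : ℝ), ENNReal.ofReal (fKernel p q ν r) * G (resample B W ν x r))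
        ∂(gaussianData μ σ) =
      (∫⁻ r in Ioi (0 : ℝ), ENNReal.ofReal (fKernel p q ν r)) * ∫⁻ x, G x ∂(gaussianData μ σ) := by
  have hp' : (0 : ℝ) < p := by exact_mod_cast hp
  have hE : (Module.finrank ℝ (LinearMap.range (lmulLin p B)) : ℝ) = p := by
    rw [finrank_range_lmulLin h.mul_self_left, hBt, mul_one]
  have hF : (Module.finrank ℝ (LinearMap.range (lmulLin p W)) : ℝ) = ν * p := by
    rw [finrank_range_lmulLin h.mul_self_right, hWt, mul_comm]
  have hE1 : Module.finrank ℝ (LinearMap.range (lmulLin p B)) = p := by exact_mod_cast hE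
  have hF1 : Module.finrank ℝ (LinearMap.range (lmulLin p W)) = q := by
    rw [← hq] at hF
    exact_mod_cast hF
  have hq1 : 1 ≤ q := by
    have : (0 : ℝ) < q := by rw [hq]; positivity
    exact_mod_cast this
  have : Nontrivial (LinearMap.range (lmulLin p B)) := Module.nontrivial_of_finrank_pos
    (R := ℝ) (by omega)
  have : Nontrivial (LinearMap.range (lmulLin p W)) := Module.nontrivial_of_finrank_pos
    (R := ℝ) (by omega)
  obtain ⟨Φ, hΦ⟩ := h.exists_decomposition (p := p)
  have hB : ∀ b : LinearMap.range (lmulLin p B), lmul B (b : Data n p) = b := by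
    rintro ⟨_, x, rfl⟩
    simp [lmul_lmul, h.mul_self_left]
  have hW : ∀ b : LinearMap.range (lmulLin p W), lmul W (b : Data n p) = b := by
    rintro ⟨_, x, rfl⟩
    simp [lmul_lmul, h.mul_self_right]
  -- Any Haar measures on the three summands will do: by uniqueness, Lebesgue measure is a constant
  -- multiple `κ` of the image of their product, and `κ` appears on both sides.
  obtain ⟨mE, _⟩ : ∃ m : Measure (LinearMap.range (lmulLin p B)), m.IsAddHaarMeasure :=
    ⟨Measure.addHaar, inferInstance⟩
  obtain ⟨mF, _⟩ : ∃ m : Measure (LinearMap.range (lmulLin p W)), m.IsAddHaarMeasure :=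
    ⟨Measure.addHaar, inferInstance⟩
  obtain ⟨mL, _⟩ : ∃ m : Measure (LinearMap.ker (lmulLin p B) ⊓ LinearMap.ker (lmulLin p W) :
    Submodule ℝ (Data n p)), m.IsAddHaarMeasure := ⟨Measure.addHaar, inferInstance⟩
  have : SFinite mE := inferInstance
  have : SFinite mF := inferInstance
  have : MeasurableAdd (LinearMap.range (lmulLin p B)) := inferInstance
  have : MeasurableAdd (LinearMap.range (lmulLin p W)) := inferInstance
  have : MeasurableAdd (LinearMap.ker (lmulLin p B) ⊓ LinearMap.ker (lmulLin p W) :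
    Submodule ℝ (Data n p)) := inferInstance
  have : (mE.prod mF).IsAddHaarMeasure := Measure.prod.instIsAddHaarMeasure _ _
  have : (mL.prod (mE.prod mF)).IsAddHaarMeasure := Measure.prod.instIsAddHaarMeasure _ _
  have : ((mL.prod (mE.prod mF)).map Φ).IsAddHaarMeasure := Φ.isAddHaarMeasure_map _
  have hvol := Measure.isAddLeftInvariant_eq_smul (volume : Measure (Data n p))
    ((mL.prod (mE.prod mF)).map Φ)
  obtain ⟨k, hk, hγ⟩ := gaussianData_eq_withDensity μ hσ
  set κ := Measure.addHaarScalarFactor (volume : Measure (Data n p))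
    ((mL.prod (mE.prod mF)).map Φ)
  have hD : Measurable fun x : Data n p =>
      ENNReal.ofReal (k * Real.exp (-(frobSq (x - μ)) / (2 * σ ^ 2))) := by fun_prop
  -- Since `μ` lies in the kernels of `B` and `W`, Pythagoras splits the exponent into a term in the
  -- residual `c` and a radial term in `(b, w)`.
  have key : ∀ H : Data n p → ℝ≥0∞, Measurable H → ∫⁻ x, H x ∂(gaussianData μ σ) =
      κ * ∫⁻ c, (∫⁻ b, (∫⁻ w, (ENNReal.ofReal (k * Real.exp (-(frobSq ((c : Data n p) - μ)) /
        (2 * σ ^ 2))) * (ENNReal.ofReal (Real.exp (-√(frobSq (b : Data n p) +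
          frobSq (w : Data n p)) ^ 2 / (2 * σ ^ 2))) * H (c + (b + w)))) ∂mF) ∂mE) ∂mL := by
    intro H hH
    have hm : Measurable fun z => (ENNReal.ofReal (k * Real.exp (-(frobSq (Φ z - μ)) /
        (2 * σ ^ 2)))) * H (Φ z) :=
      (hD.mul hH).comp Φ.continuous.measurable
    rw [hγ, lintegral_withDensity_eq_lintegral_mul _ hD hH, hvol, lintegral_smul_measure,
      lintegral_map (hD.mul hH) Φ.continuous.measurable]
    simp only [Pi.mul_apply]
    rw [lintegral_prod _ hm.aemeasurable]
    simp only [ENNReal.smul_def, smul_eq_mul]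
    congr 1
    refine lintegral_congr fun c => ?_
    refine (lintegral_prod _ (hm.comp measurable_prodMk_left).aemeasurable).trans ?_
    simp only [Function.comp_apply]
    refine lintegral_congr fun b => lintegral_congr fun w => ?_
    rw [hΦ, ← mul_assoc, ← ENNReal.ofReal_mul (by positivity)]
    congr 2
    have hcB : lmul B ((c : Data n p) - μ) = 0 := by
      rw [lmul_sub, hμB, sub_zero]
      exact c.2.1
    have hcW : lmul W ((c : Data n p) - μ) = 0 := by
      rw [lmul_sub, hμW, sub_zero]
      exact c.2.2
    have e : (c : Data n p) + ((b : Data n p) + w) - μ = (c - μ) + (b + w) := by abel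
    rw [e, h.frobSq_sum (hB b) (hW w) hcB hcW, mul_assoc, ← Real.exp_add,
      Real.sq_sqrt (add_nonneg (frobSq_nonneg _) (frobSq_nonneg _))]
    congr 2
    ring
  have hR : Measurable fun x => ∫⁻ r in Ioi (0 : ℝ),
      ENNReal.ofReal (fKernel p q ν r) * G (resample B W ν x r) := by
    refine Measurable.lintegral_prod_right' (f := fun z : Data n p × ℝ =>
      ENNReal.ofReal (fKernel p q ν z.2) * G (resample B W ν z.1 z.2)) ?_
    exact Measurable.mul (by fun_prop) (hG.comp (by fun_prop))
  have hC : ∫⁻ r in Ioi (0 : ℝ), ENNReal.ofReal (fKernel p q ν r) ≠ ∞ :=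
    (lintegral_ofReal_le_lintegral_enorm _).trans_lt (integrableOn_fKernel hp hq1 hν).2 |>.ne
  rw [key _ hR, key _ hG, mul_left_comm, ← lintegral_const_mul' _ _ hC]
  congr 1
  refine lintegral_congr fun c => ?_
  have hcB : lmul B (c : Data n p) = 0 := c.2.1
  have hcW : lmul W (c : Data n p) = 0 := c.2.2
  -- With the residual `c` frozen, the radial Gaussian factor is the weight `ψ`.
  have main := lintegral_resample_ratio mE mF
    (QE := fun b => frobSq (b : Data n p)) (by fun_prop)
    (fun s b => by simp [frobSq_smul]) (fun b hb => frobSq_pos (by simpa using hb))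
    (QF := fun b => frobSq (b : Data n p)) (by fun_prop)
    (fun s b => by simp [frobSq_smul]) (fun b hb => frobSq_pos (by simpa using hb)) hν
    (ψ := fun s => ENNReal.ofReal (Real.exp (-s ^ 2 / (2 * σ ^ 2)))) (by fun_prop)
    (K := fun z => G ((c : Data n p) + ((z.1 : Data n p) + z.2))) (hG.comp (by fun_prop))
  rw [hE1, hF1] at main
  simp_rw [lintegral_const_mul' _ _ ENNReal.ofReal_ne_top]
  rw [mul_left_comm, ← main]
  congr 1
  refine lintegral_congr fun b => lintegral_congr fun w => ?_
  congr 1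
  refine lintegral_congr fun r => ?_
  congr 2
  rw [resample, h.lmul_left_sum (hB b) (hW w) hcB, h.lmul_right_sum (hB b) (hW w) hcW,
    h.lmul_compl_sum (hB b) (hW w) hcB hcW]
  simp only [dir, Submodule.coe_smul, smul_add]
  abel

end Resample

/-! ### The projections attached to a merge -/

section Projections

variable {n p : ℕ}

lemma ind_mul_self (C : Finset (Fin n)) (i : Fin n) : ind C i * ind C i = ind C i := by
  by_cases h : i ∈ C <;> simp [ind, h]

lemma ind_mul_ind_of_disjoint {C D : Finset (Fin n)} (h : Disjoint C D) (i : Fin n) :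
    ind C i * ind D i = 0 := by
  by_cases hC : i ∈ C
  · have : i ∉ D := Finset.disjoint_left.1 h hC
    simp [ind, this]
  · simp [ind, hC]

lemma sum_ind (C : Finset (Fin n)) : ∑ i, ind C i = C.card := by
  simp [ind]

lemma centering_apply (C : Finset (Fin n)) (i j : Fin n) :
    centering C i j = (if i = j then ind C i else 0) - (C.card : ℝ)⁻¹ * (ind C i * ind C j) := by
  simp [centering, Matrix.diagonal_apply, Matrix.vecMulVec_apply]

lemma centering_transpose (C : Finset (Fin n)) : (centering C).transpose = centering C := by
  ext i j
  rw [Matrix.transpose_apply, centering_apply, centering_apply, mul_comm (ind C j)]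
  by_cases h : i = j
  · simp [h]
  · simp [h, Ne.symm h]

lemma centering_mulVec (C : Finset (Fin n)) (v : Fin n → ℝ) (i : Fin n) :
    (centering C).mulVec v i = ind C i * (v i - (C.card : ℝ)⁻¹ * ∑ k, ind C k * v k) := by
  simp only [Matrix.mulVec, dotProduct, centering_apply, sub_mul, Finset.sum_sub_distrib,
    ite_mul, zero_mul, Finset.sum_ite_eq, Finset.mem_univ, if_true, mul_sub, Finset.mul_sum]
  congr 1
  exact Finset.sum_congr rfl fun k _ => by ring

/-- A centered vector sums to zero over `C`, so a second centering subtracts nothing. -/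
lemma centering_mul_self {C : Finset (Fin n)} (hC : C.Nonempty) :
    centering C * centering C = centering C := by
  have hc : (C.card : ℝ) ≠ 0 := by exact_mod_cast hC.card_pos.ne'
  refine Matrix.ext_of_mulVec_single fun j => ?_
  funext i
  rw [← Matrix.mulVec_mulVec, centering_mulVec]
  have h1 : ∀ v : Fin n → ℝ, ∑ k, ind C k * (centering C).mulVec v k = 0 := by
    intro v
    simp only [centering_mulVec, ← mul_assoc, ind_mul_self, mul_sub, Finset.sum_sub_distrib]
    rw [← Finset.sum_mul, ← Finset.sum_mul, sum_ind, mul_inv_cancel₀ hc, one_mul, sub_self]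
  rw [h1, mul_zero, sub_zero, centering_mulVec, ← mul_assoc, ind_mul_self]

lemma centering_mul_centering {C D : Finset (Fin n)} (h : Disjoint C D) :
    centering C * centering D = 0 := by
  refine Matrix.ext_of_mulVec_single fun j => ?_
  funext i
  rw [← Matrix.mulVec_mulVec, centering_mulVec]
  simp only [centering_mulVec, mul_sub, ← mul_assoc, ind_mul_ind_of_disjoint h]
  simp

lemma centering_mulVec_eq_zero {C : Finset (Fin n)} (hC : C.Nonempty) {v : Fin n → ℝ} {a : ℝ}
    (hv : ∀ i ∈ C, v i = a) : (centering C).mulVec v = 0 := by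
  have hc : (C.card : ℝ) ≠ 0 := by exact_mod_cast hC.card_pos.ne'
  funext i
  have h1 : ∀ k, ind C k * v k = ind C k * a := by
    intro k
    by_cases hk : k ∈ C
    · rw [hv k hk]
    · simp [ind, hk]
  rw [centering_mulVec, mul_sub, h1, Finset.sum_congr rfl fun k _ => h1 k, ← Finset.sum_mul,
    sum_ind, inv_mul_cancel_left₀ hc, sub_self]
  rfl

lemma trace_centering {C : Finset (Fin n)} (hC : C.Nonempty) :
    (centering C).trace = C.card - 1 := by
  have hc : (C.card : ℝ) ≠ 0 := by exact_mod_cast hC.card_pos.ne'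
  simp only [Matrix.trace, Matrix.diag_apply, centering_apply, if_true, ind_mul_self,
    Finset.sum_sub_distrib, ← Finset.mul_sum, sum_ind, inv_mul_cancel₀ hc]

variable {M : Merge n}

lemma contrast_of_mem_left (h : Disjoint M.1 M.2) {i : Fin n} (hi : i ∈ M.1) :
    contrast M i = (M.1.card : ℝ)⁻¹ := by
  simp [contrast, ind, hi, Finset.disjoint_left.1 h hi]

lemma contrast_of_mem_right (h : Disjoint M.1 M.2) {i : Fin n} (hi : i ∈ M.2) :
    contrast M i = -(M.2.card : ℝ)⁻¹ := by
  simp [contrast, ind, hi, Finset.disjoint_right.1 h hi]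

lemma sum_contrast_sq_pos (h : Disjoint M.1 M.2) (h1 : M.1.Nonempty) :
    0 < ∑ i, contrast M i ^ 2 := by
  obtain ⟨i, hi⟩ := h1
  have hc : (0 : ℝ) < M.1.card := by exact_mod_cast Finset.card_pos.2 ⟨i, hi⟩
  refine Finset.sum_pos' (fun i _ => sq_nonneg _) ⟨i, Finset.mem_univ _, ?_⟩
  rw [contrast_of_mem_left h hi]
  positivity

lemma projW_mulVec_contrast (h : Disjoint M.1 M.2) (h1 : M.1.Nonempty) (h2 : M.2.Nonempty) :
    (projW M).mulVec (contrast M) = 0 := by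
  rw [projW, Matrix.add_mulVec,
    centering_mulVec_eq_zero h1 fun i hi => contrast_of_mem_left h hi,
    centering_mulVec_eq_zero h2 fun i hi => contrast_of_mem_right h hi, add_zero]

/-- The ranges are orthogonal because the contrast is constant on each cluster and is therefore
killed by centering. -/
lemma orthProjPair_projB_projW (h : Disjoint M.1 M.2) (h1 : M.1.Nonempty) (h2 : M.2.Nonempty) :
    OrthProjPair (projB M) (projW M) := by
  have hB : (projB M).transpose = projB M := by
    ext i j
    simp [projB, Matrix.vecMulVec_apply, mul_comm]
  have hW : (projW M).transpose = projW M := by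
    rw [projW, Matrix.transpose_add, centering_transpose, centering_transpose]
  have hWB : projW M * projB M = 0 := by
    rw [projB, Matrix.mul_smul, Matrix.mul_vecMulVec, projW_mulVec_contrast h h1 h2]
    simp
  refine ⟨hB, hW, ?_, ?_, ?_, hWB⟩
  · have hs := (sum_contrast_sq_pos h h1).ne'
    have hd : contrast M ⬝ᵥ contrast M = ∑ i, contrast M i ^ 2 := by
      simp [dotProduct, sq]
    rw [projB, Matrix.smul_mul, Matrix.mul_smul, Matrix.vecMulVec_mul_vecMulVec, hd,
      smul_smul, Matrix.vecMulVec_smul, smul_smul, mul_assoc, inv_mul_cancel₀ hs, mul_one]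
  · rw [projW, mul_add, add_mul, add_mul, centering_mul_self h1, centering_mul_self h2,
      centering_mul_centering h, centering_mul_centering h.symm, add_zero, zero_add]
  · rw [← hB, ← hW, ← Matrix.transpose_mul, hWB, Matrix.transpose_zero]

lemma trace_projB (h : Disjoint M.1 M.2) (h1 : M.1.Nonempty) : (projB M).trace = 1 := by
  have hs := (sum_contrast_sq_pos h h1).ne'
  simp only [projB, Matrix.trace, Matrix.diag_apply, Matrix.smul_apply, Matrix.vecMulVec_apply,
    smul_eq_mul, ← Finset.mul_sum, ← sq]
  exact inv_mul_cancel₀ hs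

lemma trace_projW (h1 : M.1.Nonempty) (h2 : M.2.Nonempty) : (projW M).trace = dof M := by
  rw [projW, Matrix.trace_add, trace_centering h1, trace_centering h2, dof]
  ring

lemma lmul_apply_eq_mulVec (A : Matrix (Fin n) (Fin n) ℝ) (x : Data n p) (i : Fin n) (j : Fin p) :
    lmul A x i j = A.mulVec (fun k => x k j) i := rfl

/-- Together with `lmul_projB_eq_zero`, this is how the null hypothesis enters: the mean contributes
only to the residual. -/
lemma lmul_projW_eq_zero (h1 : M.1.Nonempty) (h2 : M.2.Nonempty)
    {μ : Data n p} (hμ : ∀ i ∈ M.1 ∪ M.2, ∀ j ∈ M.1 ∪ M.2, μ i = μ j) :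
    lmul (projW M) μ = 0 := by
  obtain ⟨i₀, hi₀⟩ := h1
  have hi₀' : i₀ ∈ M.1 ∪ M.2 := Finset.mem_union_left _ hi₀
  funext i j
  rw [lmul_apply_eq_mulVec, projW, Matrix.add_mulVec,
    centering_mulVec_eq_zero (a := μ i₀ j) ⟨i₀, hi₀⟩ fun i hi => by
      rw [hμ i (Finset.mem_union_left _ hi) i₀ hi₀'],
    centering_mulVec_eq_zero (a := μ i₀ j) h2 fun i hi => by
      rw [hμ i (Finset.mem_union_right _ hi) i₀ hi₀']]
  simp

lemma lmul_projB_eq_zero (h1 : M.1.Nonempty) (h2 : M.2.Nonempty)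
    {μ : Data n p} (hμ : ∀ i ∈ M.1 ∪ M.2, ∀ j ∈ M.1 ∪ M.2, μ i = μ j) :
    lmul (projB M) μ = 0 := by
  have hc1 : (M.1.card : ℝ) ≠ 0 := by exact_mod_cast h1.card_pos.ne'
  have hc2 : (M.2.card : ℝ) ≠ 0 := by exact_mod_cast h2.card_pos.ne'
  obtain ⟨i₀, hi₀⟩ := h1
  have hi₀' : i₀ ∈ M.1 ∪ M.2 := Finset.mem_union_left _ hi₀
  have h0 : ∀ C ⊆ M.1 ∪ M.2, ∀ k j, ind C k * μ k j = ind C k * μ i₀ j := by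
    intro C hC k j
    by_cases hk : k ∈ C
    · rw [hμ k (hC hk) i₀ hi₀']
    · simp [ind, hk]
  have hs : ∀ j, ∑ k, contrast M k * μ k j = 0 := by
    intro j
    simp only [contrast, sub_mul, div_mul_eq_mul_div, Finset.sum_sub_distrib,
      h0 _ Finset.subset_union_left, h0 _ Finset.subset_union_right]
    rw [← Finset.sum_div, ← Finset.sum_div, ← Finset.sum_mul, ← Finset.sum_mul, sum_ind, sum_ind,
      mul_div_cancel_left₀ _ hc1, mul_div_cancel_left₀ _ hc2, sub_self]
  funext i j
  simp only [lmul, projB, Matrix.smul_apply, Matrix.vecMulVec_apply, smul_eq_mul, mul_assoc,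
    ← Finset.mul_sum, hs]
  simp

end Projections

/-! ### The resampling path through a data set -/

section Resample

variable {n p : ℕ} {B W : Matrix (Fin n) (Fin n) ℝ} {ν : ℝ} {x : Data n p}

lemma frobSq_dir (hx : x ≠ 0) : frobSq (dir x) = 1 := by
  have h := frobSq_pos hx
  rw [dir, frobSq_smul, inv_pow, Real.sq_sqrt h.le, inv_mul_cancel₀ h.ne']

lemma dir_smul {c : ℝ} (hc : 0 < c) (x : Data n p) : dir (c • x) = dir x := by
  rw [dir, frobSq_smul, Real.sqrt_mul (sq_nonneg c), Real.sqrt_sq hc.le, smul_smul, mul_inv,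
    mul_assoc, mul_comm _ c, ← mul_assoc, inv_mul_cancel₀ hc.ne', one_mul, dir]

lemma dir_dir (x : Data n p) : dir (dir x) = dir x := by
  by_cases hx : x = 0
  · simp [hx, dir]
  · have h := frobSq_pos hx
    conv_lhs => rw [dir, frobSq_dir hx]
    simp

lemma OrthProjPair.lmul_left_resample (h : OrthProjPair B W) (x : Data n p) (r : ℝ) :
    lmul B (resample B W ν x r) =
      (√(frobSq (lmul B x) + frobSq (lmul W x)) * √(r / (ν + r))) • dir (lmul B x) := by
  rw [resample, add_comm, smul_add, h.lmul_left_sum _ _ (h.lmul_left_compl x), smul_smul]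
  · rw [lmul_smul, lmul_smul, lmul_dir _ h.mul_self_left]
  · rw [lmul_smul, lmul_smul, lmul_dir _ h.mul_self_right]

lemma OrthProjPair.lmul_right_resample (h : OrthProjPair B W) (x : Data n p) (r : ℝ) :
    lmul W (resample B W ν x r) =
      (√(frobSq (lmul B x) + frobSq (lmul W x)) * √(ν / (ν + r))) • dir (lmul W x) := by
  rw [resample, add_comm, smul_add, h.lmul_right_sum _ _ (h.lmul_right_compl x), smul_smul]
  · rw [lmul_smul, lmul_smul, lmul_dir _ h.mul_self_left]
  · rw [lmul_smul, lmul_smul, lmul_dir _ h.mul_self_right]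

lemma OrthProjPair.lmul_compl_resample (h : OrthProjPair B W) (x : Data n p) (r : ℝ) :
    lmul (1 - B - W) (resample B W ν x r) = lmul (1 - B - W) x := by
  rw [resample, add_comm, smul_add, h.lmul_compl_sum _ _ (h.lmul_left_compl x)
    (h.lmul_right_compl x)]
  · rw [lmul_smul, lmul_smul, lmul_dir _ h.mul_self_left]
  · rw [lmul_smul, lmul_smul, lmul_dir _ h.mul_self_right]

lemma OrthProjPair.frobSq_left_resample (h : OrthProjPair B W) (hν : 0 < ν)
    (hB : lmul B x ≠ 0) {r : ℝ} (hr : 0 < r) :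
    frobSq (lmul B (resample B W ν x r)) =
      (frobSq (lmul B x) + frobSq (lmul W x)) * (r / (ν + r)) := by
  have := frobSq_nonneg (lmul B x)
  have := frobSq_nonneg (lmul W x)
  rw [h.lmul_left_resample, frobSq_smul, frobSq_dir hB, mul_pow, Real.sq_sqrt (by positivity),
    Real.sq_sqrt (by positivity), mul_one]

lemma OrthProjPair.frobSq_right_resample (h : OrthProjPair B W) (hν : 0 < ν)
    (hW : lmul W x ≠ 0) {r : ℝ} (hr : 0 < r) :
    frobSq (lmul W (resample B W ν x r)) =
      (frobSq (lmul B x) + frobSq (lmul W x)) * (ν / (ν + r)) := by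
  have := frobSq_nonneg (lmul B x)
  have := frobSq_nonneg (lmul W x)
  rw [h.lmul_right_resample, frobSq_smul, frobSq_dir hW, mul_pow, Real.sq_sqrt (by positivity),
    Real.sq_sqrt (by positivity), mul_one]

/-- Both directions are unit vectors, so the total length cancels and the parameter of the path is
its test statistic. -/
lemma OrthProjPair.ratio_resample (h : OrthProjPair B W) (hν : 0 < ν)
    (hB : lmul B x ≠ 0) (hW : lmul W x ≠ 0) {r : ℝ} (hr : 0 < r) :
    ν * (frobSq (lmul B (resample B W ν x r)) / frobSq (lmul W (resample B W ν x r))) = r := by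
  have := frobSq_pos hB
  have := frobSq_pos hW
  rw [h.frobSq_left_resample hν hB hr, h.frobSq_right_resample hν hW hr]
  field_simp

/-- The path is built from the directions, the total length and the residual, which are constant
along it; `r > 0` keeps the rescaling of the `B` component positive, so its direction survives. -/
lemma OrthProjPair.resample_resample (h : OrthProjPair B W) (hν : 0 < ν)
    (hB : lmul B x ≠ 0) (hW : lmul W x ≠ 0) {r : ℝ} (hr : 0 < r) :
    resample B W ν (resample B W ν x r) = resample B W ν x := by
  have h1 := frobSq_pos hB
  have h2 := frobSq_pos hW
  funext r'
  have hS : frobSq (lmul B (resample B W ν x r)) + frobSq (lmul W (resample B W ν x r)) =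
      frobSq (lmul B x) + frobSq (lmul W x) := by
    rw [h.frobSq_left_resample hν hB hr, h.frobSq_right_resample hν hW hr]
    field_simp
    ring
  rw [resample, hS, h.lmul_compl_resample, h.lmul_left_resample, h.lmul_right_resample,
    dir_smul (by positivity), dir_smul (by positivity), dir_dir, dir_dir, resample]

/-- A nonzero trace makes the kernel a proper subspace, hence Lebesgue null. Thus the directions are
almost surely well defined. -/
lemma gaussianData_ae_lmul_ne_zero (μ : Data n p) {σ : ℝ≥0} (hσ : 0 < σ)
    {A : Matrix (Fin n) (Fin n) ℝ} (hp : 1 ≤ p) (hA : A.trace ≠ 0) :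
    ∀ᵐ x ∂(gaussianData μ σ), lmul A x ≠ 0 := by
  obtain ⟨k, _, hγ⟩ := gaussianData_eq_withDensity μ hσ
  have hac : gaussianData μ σ ≪ volume := hγ ▸ withDensity_absolutelyContinuous _ _
  refine hac.ae_le ?_
  have hk : LinearMap.ker (lmulLin p A) ≠ ⊤ := by
    intro h
    have h0 := trace_lmulLin (p := p) A
    rw [LinearMap.ker_eq_top.1 h, map_zero] at h0
    have : (p : ℝ) ≠ 0 := by exact_mod_cast (by omega : p ≠ 0)
    exact mul_ne_zero this hA h0.symm
  have := Measure.addHaar_submodule (volume : Measure (Data n p)) _ hk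
  refine measure_mono_null (fun x hx => ?_) this
  simpa using hx

end Resample

/-! ### The probability integral transform -/

section ProbabilityIntegralTransform

/-- The probability integral transform: if `g` is an unnormalized density on `(0, ∞)`, then its
normalized survival function, evaluated at a draw from `g`, is below `u` with probability at
most `u`. -/
lemma setLIntegral_survival_lt_le {g : ℝ → ℝ} (hg0 : ∀ r, 0 ≤ g r) (hg : IntegrableOn g (Ioi 0))
    {u : ℝ} (hu : 0 ≤ u) :
    ∫⁻ r in Ioi 0 ∩ {r | 1 - (∫ s in Ioc 0 r, g s) / ∫ s in Ioi 0, g s < u}, ENNReal.ofReal (g r) ≤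
      ENNReal.ofReal u * ∫⁻ r in Ioi 0, ENNReal.ofReal (g r) := by
  set I := ∫ s in Ioi 0, g s with hI
  have hlin : ∫⁻ r in Ioi 0, ENNReal.ofReal (g r) = ENNReal.ofReal I :=
    (ofReal_integral_eq_lintegral_ofReal hg (Filter.Eventually.of_forall hg0)).symm
  set A := Ioi 0 ∩ {r | 1 - (∫ s in Ioc 0 r, g s) / I < u} with hA
  rcases A.eq_empty_or_nonempty with hAe | hAne
  · simp [hAe]
  rcases (setIntegral_nonneg measurableSet_Ioi fun r _ => hg0 r : 0 ≤ I).eq_or_lt with h0 | hpos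
  · refine (lintegral_mono_set inter_subset_left).trans ?_
    have h0' : I = 0 := h0.symm
    simp [hlin, h0']
  -- The set `A` lies in `[a, ∞)`, and by continuity the survival function at `a` is still at most
  -- `u`, so the mass of `(a, ∞)` bounds that of `A`. Strict monotonicity of the distribution
  -- function is not needed.
  set a := sInf A with ha
  have hbdd : BddBelow A := ⟨0, fun r hr => le_of_lt hr.1⟩
  have ha0 : 0 ≤ a := le_csInf hAne fun r hr => le_of_lt hr.1
  have hii : ∀ b c, IntervalIntegrable ((Ioi 0).indicator g) volume b c := fun b c =>
    ((integrable_indicator_iff measurableSet_Ioi).2 hg).intervalIntegrable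
  have hcont := intervalIntegral.continuous_primitive hii 0
  have hprim : ∀ r, 0 ≤ r → ∫ s in (0 : ℝ)..r, (Ioi 0).indicator g s = ∫ s in Ioc 0 r, g s := by
    intro r hr
    rw [intervalIntegral.integral_of_le hr]
    exact setIntegral_congr_fun measurableSet_Ioc fun s hs => indicator_of_mem hs.1 g
  have hclosed : IsClosed {r : ℝ | 1 - (∫ s in (0 : ℝ)..r, (Ioi 0).indicator g s) / I ≤ u} :=
    isClosed_le (by fun_prop) continuous_const
  have hmem : a ∈ {r : ℝ | 1 - (∫ s in (0 : ℝ)..r, (Ioi 0).indicator g s) / I ≤ u} := by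
    refine hclosed.closure_subset_iff.2 (fun r hr => ?_) (csInf_mem_closure hAne hbdd)
    have h1 := hr.2
    simp only [mem_ofPred_eq] at h1 ⊢
    rw [hprim r (le_of_lt hr.1)]
    exact h1.le
  simp only [mem_ofPred_eq] at hmem
  rw [hprim a ha0] at hmem
  have hsplit : I = (∫ s in Ioc 0 a, g s) + ∫ s in Ioi a, g s := by
    rw [hI, ← Ioc_union_Ioi_eq_Ioi ha0, setIntegral_union (Ioc_disjoint_Ioi le_rfl)
      measurableSet_Ioi (hg.mono_set Ioc_subset_Ioi_self) (hg.mono_set (Ioi_subset_Ioi ha0))]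
  have hle : ∫ s in Ioi a, g s ≤ u * I := by
    have : (1 - (∫ s in Ioc 0 a, g s) / I) * I ≤ u * I :=
      mul_le_mul_of_nonneg_right hmem hpos.le
    rw [sub_mul, div_mul_cancel₀ _ hpos.ne', one_mul] at this
    linarith
  calc ∫⁻ r in A, ENNReal.ofReal (g r) ≤ ∫⁻ r in Ici a, ENNReal.ofReal (g r) :=
        lintegral_mono_set fun r hr => csInf_le hbdd hr
    _ = ∫⁻ r in Ioi a, ENNReal.ofReal (g r) := by rw [restrict_Ioi_eq_restrict_Ici]
    _ = ENNReal.ofReal (∫ s in Ioi a, g s) :=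
        (ofReal_integral_eq_lintegral_ofReal (hg.mono_set (Ioi_subset_Ioi ha0))
          (Filter.Eventually.of_forall hg0)).symm
    _ ≤ ENNReal.ofReal (u * I) := ENNReal.ofReal_le_ofReal hle
    _ = _ := by rw [hlin, ENNReal.ofReal_mul hu]

end ProbabilityIntegralTransform

/-! ### The F density -/

section FDensity

/-- With `ν * p` denominator degrees of freedom, the argument `(a / b) * r` of the density is `r /
ν`; only the normalizing constant remains. -/
lemma fDensity_eq_fKernel {p q : ℕ} (hp : 1 ≤ p) {ν : ℝ} (hν : 0 < ν) (hq : (q : ℝ) = ν * p) :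
    ∃ c : ℝ, 0 < c ∧ ∀ r, 0 < r → fDensity p (ν * p) r = c * fKernel p q ν r := by
  have hp' : (0 : ℝ) < p := by exact_mod_cast hp
  refine ⟨((p : ℝ) / (ν * p)) ^ ((p : ℝ) / 2) /
    ProbabilityTheory.beta ((p : ℝ) / 2) (ν * p / 2), ?_, fun r hr => ?_⟩
  · have := ProbabilityTheory.beta_pos (α := (p : ℝ) / 2) (β := ν * p / 2) (by positivity)
      (by positivity)
    positivity
  · have e1 : (p : ℝ) / (ν * p) * r = r / ν := by field_simp
    rw [fDensity, if_pos hr, fKernel, e1, hq, mul_assoc]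

lemma fDensity_nonneg {a b : ℝ} (ha : 0 < a) (hb : 0 < b) (r : ℝ) : 0 ≤ fDensity a b r := by
  unfold fDensity
  split_ifs with h
  · have := ProbabilityTheory.beta_pos (half_pos ha) (half_pos hb)
    positivity
  · exact le_rfl

@[fun_prop]
lemma measurable_fDensity (a b : ℝ) : Measurable (fDensity a b) :=
  Measurable.ite measurableSet_Ioi (by fun_prop) measurable_const

end FDensity

/-! ### Bounds and measurability of the selection probabilities -/

section Selection

variable {n p : ℕ} {d : Merge n → Data n p → ℝ} {τ : ℝ}

lemma selProb_nonneg (C : Finset (Finset (Fin n))) (N : Merge n) (x : Data n p) :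
    0 ≤ selProb d τ C N x := by
  unfold selProb
  split_ifs
  · positivity
  · exact le_rfl

lemma selProb_le_one (C : Finset (Finset (Fin n))) (N : Merge n) (x : Data n p) :
    selProb d τ C N x ≤ 1 := by
  unfold selProb
  split_ifs with h
  · refine div_le_one_of_le₀ ?_ (by positivity)
    exact Finset.single_le_sum
      (f := fun N => Real.exp (-(1 / tauStep d τ C x) * d N x)) (fun _ _ => by positivity) h
  · exact zero_le_one

lemma measurable_selProb (hd : ∀ c, Measurable (d c)) (C : Finset (Finset (Fin n)))
    (N : Merge n) : Measurable (selProb d τ C N) := by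
  unfold selProb tauStep
  split_ifs <;> fun_prop

lemma historyProb_nonneg (m : ℕ → Merge n) (t : ℕ) (x : Data n p) : 0 ≤ historyProb d τ m t x :=
  Finset.prod_nonneg fun _ _ => selProb_nonneg _ _ _

lemma historyProb_le_one (m : ℕ → Merge n) (t : ℕ) (x : Data n p) : historyProb d τ m t x ≤ 1 :=
  Finset.prod_le_one (fun _ _ => selProb_nonneg _ _ _) fun _ _ => selProb_le_one _ _ _

lemma measurable_historyProb (hd : ∀ c, Measurable (d c)) (m : ℕ → Merge n) (t : ℕ) :
    Measurable (historyProb d τ m t) :=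
  Finset.measurable_fun_prod _ fun _ _ => measurable_selProb hd _ _

end Selection

/-! ### Validity of the selective p-value for a fixed history -/

section Validity

variable {n p : ℕ} {d : Merge n → Data n p → ℝ} {τ : ℝ}

lemma dataAt_eq_resample (N : Merge n) (x : Data n p) :
    dataAt N x = resample (projB N) (projW N) (dof N) x := rfl

lemma measurable_condDensity (hd : ∀ c, Measurable (d c)) (m : ℕ → Merge n) (t : ℕ) :
    Measurable fun z : Data n p × ℝ => condDensity d τ m t z.1 z.2 := by
  unfold condDensity
  refine Measurable.mul (by fun_prop) ((measurable_historyProb hd m t).comp ?_)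
  simp only [dataAt_eq_resample]
  fun_prop

lemma measurable_pValue (hd : ∀ c, Measurable (d c)) (m : ℕ → Merge n) (t : ℕ) :
    Measurable (pValue d τ m t) := by
  have hc := measurable_condDensity (τ := τ) hd m t
  have hT : Measurable (testStat (m t) : Data n p → ℝ) := by
    unfold testStat bcss wcss
    fun_prop
  have hnum : Measurable fun x => ∫ r in Ioc 0 (testStat (m t) x), condDensity d τ m t x r := by
    -- The domain of integration moves with `x`; an indicator on the product space turns this into
    -- an ordinary parametric integral.
    have h1 : ∀ x, ∫ r in Ioc 0 (testStat (m t) x), condDensity d τ m t x r =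
        ∫ r, {z : Data n p × ℝ | 0 < z.2 ∧ z.2 ≤ testStat (m t) z.1}.indicator
          (fun z => condDensity d τ m t z.1 z.2) (x, r) := by
      intro x
      rw [← integral_indicator measurableSet_Ioc]
      rfl
    simp_rw [h1]
    refine StronglyMeasurable.measurable (StronglyMeasurable.integral_prod_right' ?_)
    refine (hc.indicator ?_).stronglyMeasurable
    exact (measurableSet_lt measurable_const measurable_snd).inter
      (measurableSet_le measurable_snd (hT.comp measurable_fst))
  have hden : Measurable fun x => ∫ r in Ioi 0, condDensity d τ m t x r :=
    (hc.stronglyMeasurable.integral_prod_right' (ν := volume.restrict (Ioi 0))).measurable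
  unfold pValue condCDF
  fun_prop

/-- Validity of the selective p-value: among data sets whose clustering history starts with
`m 1, …, m t`, the p-value of step `t` is below `u` with conditional probability at most `u`, if
the two clusters merged at step `t` have a common mean. -/
theorem setLIntegral_pValue_lt_le (hp : 1 ≤ p) (hd : ∀ c, Measurable (d c)) (m : ℕ → Merge n)
    (t : ℕ) (hdisj : Disjoint (m t).1 (m t).2) (h1 : 2 ≤ (m t).1.card) (h2 : 2 ≤ (m t).2.card)
    {μ : Data n p} (hμ : ∀ i ∈ (m t).1 ∪ (m t).2, ∀ j ∈ (m t).1 ∪ (m t).2, μ i = μ j)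
    {σ : ℝ≥0} (hσ : 0 < σ) {u : ℝ} (hu : 0 ≤ u) :
    ∫⁻ x in {x | pValue d τ m t x < u}, ENNReal.ofReal (historyProb d τ m t x)
      ∂(gaussianData μ σ) ≤
    ENNReal.ofReal u * ∫⁻ x, ENNReal.ofReal (historyProb d τ m t x) ∂(gaussianData μ σ) := by
  have hp' : (0 : ℝ) < p := by exact_mod_cast hp
  have n1 : (m t).1.Nonempty := Finset.card_pos.1 (by omega)
  have n2 : (m t).2.Nonempty := Finset.card_pos.1 (by omega)
  set ν := dof (m t) with hνdef
  have hν : 0 < ν := by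
    have e1 : (2 : ℝ) ≤ (m t).1.card := by exact_mod_cast h1
    have e2 : (2 : ℝ) ≤ (m t).2.card := by exact_mod_cast h2
    rw [hνdef, dof]
    linarith
  obtain ⟨q, hq⟩ : ∃ q : ℕ, (q : ℝ) = ν * p := by
    refine ⟨((m t).1.card + (m t).2.card - 2) * p, ?_⟩
    rw [Nat.cast_mul, Nat.cast_sub (by omega)]
    push_cast
    rfl
  have hq1 : 1 ≤ q := by
    have : (0 : ℝ) < q := by rw [hq]; positivity
    exact_mod_cast this
  have hBW := orthProjPair_projB_projW hdisj n1 n2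
  have htB := trace_projB hdisj n1
  have htW := trace_projW (M := m t) n1 n2
  obtain ⟨c, hc, hcf⟩ := fDensity_eq_fKernel hp hν hq
  have hf0 : ∀ r, 0 ≤ fDensity p (ν * p) r := fDensity_nonneg hp' (by positivity)
  have hfint : IntegrableOn (fDensity p (ν * p)) (Ioi 0) := by
    have hk : IntegrableOn (fun r => c * fKernel p q ν r) (Ioi 0) :=
      (integrableOn_fKernel hp hq1 hν).const_mul c
    exact hk.congr_fun (fun r hr => (hcf r hr).symm) measurableSet_Ioi
  set C := ∫⁻ r in Ioi (0 : ℝ), ENNReal.ofReal (fKernel p q ν r) with hC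
  have hCtop : C ≠ ∞ :=
    (lintegral_ofReal_le_lintegral_enorm _).trans_lt (integrableOn_fKernel hp hq1 hν).2 |>.ne
  have hC0 : C ≠ 0 := by
    refine ne_of_gt ?_
    rw [hC, lintegral_pos_iff_support (by fun_prop)]
    have hsup : Ioi (0 : ℝ) ⊆
        Function.support fun r => ENNReal.ofReal (fKernel p q ν r) := by
      intro r (hr : 0 < r)
      have : 0 < fKernel p q ν r := by
        unfold fKernel
        positivity
      simpa using this
    refine lt_of_lt_of_le ?_ (measure_mono hsup)
    simp
  -- The invariance of the Gaussian law, written with the F density. The constant is the same for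
  -- every `G`, so it can be cancelled from an inequality.
  have key : ∀ G : Data n p → ℝ≥0∞, Measurable G →
      ∫⁻ x, (∫⁻ r in Ioi (0 : ℝ), ENNReal.ofReal (fDensity p (ν * p) r) * G (dataAt (m t) x r))
        ∂(gaussianData μ σ) = ENNReal.ofReal c * C * ∫⁻ x, G x ∂(gaussianData μ σ) := by
    intro G hG
    rw [mul_assoc, ← hBW.lintegral_resample hp htB hν htW hq (lmul_projB_eq_zero n1 n2 hμ)
      (lmul_projW_eq_zero n1 n2 hμ) hσ hG, ← lintegral_const_mul' _ _ ENNReal.ofReal_ne_top]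
    refine lintegral_congr fun x => ?_
    rw [← lintegral_const_mul' _ _ ENNReal.ofReal_ne_top]
    refine setLIntegral_congr_fun measurableSet_Ioi fun r hr => ?_
    rw [hcf r hr, ENNReal.ofReal_mul hc.le, mul_assoc]
    rfl
  have hA : MeasurableSet {x | pValue d τ m t x < u} :=
    measurableSet_lt (measurable_pValue hd m t) measurable_const
  have hh : Measurable fun x => ENNReal.ofReal (historyProb d τ m t x) :=
    (measurable_historyProb hd m t).ennreal_ofReal
  have hc0 : ENNReal.ofReal c * C ≠ 0 := by
    simp only [ne_eq, mul_eq_zero, not_or]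
    exact ⟨by simpa using hc, hC0⟩
  have hctop : ENNReal.ofReal c * C ≠ ∞ := ENNReal.mul_ne_top ENNReal.ofReal_ne_top hCtop
  -- Both sides are rewritten as averages over resampling paths, so it suffices to compare them on
  -- almost every path.
  rw [← lintegral_indicator hA, ← ENNReal.mul_le_mul_iff_right hc0 hctop,
    ← key _ (hh.indicator hA), mul_left_comm, ← key _ hh,
    ← lintegral_const_mul' _ _ ENNReal.ofReal_ne_top]
  refine lintegral_mono_ae ?_
  filter_upwards [gaussianData_ae_lmul_ne_zero μ hσ hp (by rw [htB]; exact one_ne_zero),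
    gaussianData_ae_lmul_ne_zero μ hσ hp (by rw [htW]; exact hν.ne')] with x hxB hxW
  have hcond : ∀ r, ENNReal.ofReal (condDensity d τ m t x r) =
      ENNReal.ofReal (fDensity p (ν * p) r) *
        ENNReal.ofReal (historyProb d τ m t (dataAt (m t) x r)) := fun r =>
    ENNReal.ofReal_mul (hf0 r)
  have hg0 : ∀ r, 0 ≤ condDensity d τ m t x r := fun r =>
    mul_nonneg (hf0 r) (historyProb_nonneg _ _ _)
  have hg : IntegrableOn (condDensity d τ m t x) (Ioi 0) := by
    refine hfint.mono' ((measurable_condDensity hd m t).comp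
      measurable_prodMk_left).aestronglyMeasurable (Filter.Eventually.of_forall fun r => ?_)
    rw [Real.norm_of_nonneg (hg0 r)]
    exact mul_le_of_le_one_right (hf0 r) (historyProb_le_one _ _ _)
  have hcdf : ∀ r, condCDF d τ m t x r = (∫ s in Ioc 0 r, condDensity d τ m t x s) /
    ∫ s in Ioi 0, condDensity d τ m t x s := fun r => rfl
  have hpit := setLIntegral_survival_lt_le hg0 hg hu
  simp only [← hcdf, hcond] at hpit
  rw [inter_comm, ← Measure.restrict_restrict' measurableSet_Ioi] at hpit
  refine le_trans (le_of_eq ?_) ((lintegral_indicator_le _ _).trans hpit)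
  refine setLIntegral_congr_fun measurableSet_Ioi fun r (hr : 0 < r) => ?_
  -- At the point `r` of the path the statistic is `r`, and the conditional density is that of `x`
  -- because the path is the same.
  have hpv : pValue d τ m t (dataAt (m t) x r) = 1 - condCDF d τ m t x r := by
    have hT : testStat (m t) (dataAt (m t) x r) = r := hBW.ratio_resample hν hxB hxW hr
    have hD : dataAt (m t) (dataAt (m t) x r) = dataAt (m t) x :=
      hBW.resample_resample hν hxB hxW hr
    have hcd : condDensity d τ m t (dataAt (m t) x r) = condDensity d τ m t x := by
      funext s
      rw [condDensity, hD, condDensity]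
    rw [pValue, hT, condCDF, hcd, condCDF]
  simp only [indicator, mem_ofPred_eq, hpv]
  split_ifs <;> simp

end Validity

/-! ### Dependence on finitely many merges, and disjointness of clusters -/

section Histories

variable {n p : ℕ} {d : Merge n → Data n p → ℝ} {τ : ℝ}

lemma clustersAfter_congr {m m' : ℕ → Merge n} {t : ℕ}
    (h : ∀ s ∈ Finset.Icc 1 t, m s = m' s) : clustersAfter m t = clustersAfter m' t := by
  induction t with
  | zero => rfl
  | succ t ih =>
    have hs : ∀ s ∈ Finset.Icc 1 t, m s = m' s := fun s hs => h s (by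
      simp only [Finset.mem_Icc] at hs ⊢
      omega)
    rw [clustersAfter, clustersAfter, ih hs, h (t + 1) (by simp)]

lemma historyProb_congr {m m' : ℕ → Merge n} {t : ℕ}
    (h : ∀ s ∈ Finset.Icc 1 t, m s = m' s) :
    historyProb d τ m t = historyProb d τ m' t := by
  funext x
  refine Finset.prod_congr rfl fun s hs => ?_
  rw [h s hs, clustersAfter_congr fun r hr => h r (by
    simp only [Finset.mem_Icc] at hr hs ⊢
    omega)]

lemma pValue_congr {m m' : ℕ → Merge n} {t : ℕ} (ht : 1 ≤ t)
    (h : ∀ s ∈ Finset.Icc 1 t, m s = m' s) : pValue d τ m t = pValue d τ m' t := by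
  have hc : condDensity d τ m t = condDensity d τ m' t := by
    funext x r
    rw [condDensity, condDensity, historyProb_congr h, h t (by simp [ht])]
  funext x
  rw [pValue, pValue, condCDF, condCDF, hc, h t (by simp [ht])]

/-- By induction: a surviving cluster is disjoint from both merged clusters, hence from their union.
-/
lemma pairwiseDisjoint_clustersAfter {m : ℕ → Merge n} {t : ℕ}
    (h : ∀ s ∈ Finset.Icc 1 t, m s ∈ candidates (clustersAfter m (s - 1))) :
    ∀ C ∈ clustersAfter m t, ∀ D ∈ clustersAfter m t, C ≠ D → Disjoint C D := by
  induction t with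
  | zero =>
    intro C hC D hD hCD
    simp only [clustersAfter, Finset.mem_image, Finset.mem_univ, true_and] at hC hD
    obtain ⟨i, rfl⟩ := hC
    obtain ⟨j, rfl⟩ := hD
    rw [Finset.disjoint_singleton]
    rintro rfl
    exact hCD rfl
  | succ t ih =>
    have ih' := ih fun s hs => h s (by
      simp only [Finset.mem_Icc] at hs ⊢
      omega)
    have hm := h (t + 1) (by simp)
    simp only [candidates, Finset.mem_filter, Finset.mem_product, Nat.add_sub_cancel] at hm
    have aux : ∀ C ∈ clustersAfter m t, C ≠ (m (t + 1)).1 → C ≠ (m (t + 1)).2 →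
        Disjoint C ((m (t + 1)).1 ∪ (m (t + 1)).2) := fun C hC h1 h2 =>
      Finset.disjoint_union_right.2 ⟨ih' C hC _ hm.1.1 h1, ih' C hC _ hm.1.2 h2⟩
    intro C hC D hD hCD
    simp only [clustersAfter, Finset.mem_union, Finset.mem_sdiff, Finset.mem_insert,
      Finset.mem_singleton, not_or] at hC hD
    rcases hC with ⟨hC, hC1, hC2⟩ | rfl <;> rcases hD with ⟨hD, hD1, hD2⟩ | rfl
    · exact ih' C hC D hD hCD
    · exact aux C hC hC1 hC2
    · exact (aux D hD hD1 hD2).symm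
    · exact absurd rfl hCD

/-- A nonzero product forces every merge to be a candidate, so the clusters stay disjoint; the
strict order of the minima in `candidates` excludes merging a cluster with itself. -/
lemma disjoint_of_historyProb_ne_zero {m : ℕ → Merge n} {t : ℕ} (ht : 1 ≤ t) {x : Data n p}
    (h : historyProb d τ m t x ≠ 0) : Disjoint (m t).1 (m t).2 := by
  have hc : ∀ s ∈ Finset.Icc 1 t, m s ∈ candidates (clustersAfter m (s - 1)) := by
    intro s hs
    by_contra hcon
    exact Finset.prod_ne_zero_iff.1 h s hs (if_neg hcon)
  have hm := hc t (by simp [ht])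
  simp only [candidates, Finset.mem_filter, Finset.mem_product] at hm
  refine pairwiseDisjoint_clustersAfter (t := t - 1) (fun s hs => hc s ?_) _ hm.1.1 _ hm.1.2 ?_
  · simp only [Finset.mem_Icc] at hs ⊢
    omega
  · intro heq
    exact absurd hm.2 (by rw [heq]; exact lt_irrefl _)

end Histories

/-! ### Accounting for the spent levels -/

section Levels

variable {n p : ℕ} {d : Merge n → Data n p → ℝ} {τ nMin nStar : ℝ}

/-- The levels that have not been spent after the first `t` merges of the history `m`, if no test
rejects. -/
def unusedLevels (nMin nStar : ℝ) (S : Multiset ℝ) (m : ℕ → Merge n) : ℕ → Multiset ℝ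
  | 0 => S
  | t + 1 =>
    if minSize (m (t + 1)) ≤ nMin then unusedLevels nMin nStar S m t
    else (unusedLevels nMin nStar S m t).erase
      (testLevel nStar (unusedLevels nMin nStar S m t) (m (t + 1)))

/-- The level spent at step `t + 1`, which is `0` if no test is made. -/
def spentLevel (nMin nStar : ℝ) (S : Multiset ℝ) (m : ℕ → Merge n) (t : ℕ) : ℝ :=
  if minSize (m (t + 1)) ≤ nMin then 0
  else testLevel nStar (unusedLevels nMin nStar S m t) (m (t + 1))

lemma unusedLevels_congr {S : Multiset ℝ} {m m' : ℕ → Merge n} {t : ℕ}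
    (h : ∀ s ∈ Finset.Icc 1 t, m s = m' s) :
    unusedLevels nMin nStar S m t = unusedLevels nMin nStar S m' t := by
  induction t with
  | zero => rfl
  | succ t ih =>
    have hs : ∀ s ∈ Finset.Icc 1 t, m s = m' s := fun s hs => h s (by
      simp only [Finset.mem_Icc] at hs ⊢
      omega)
    rw [unusedLevels, unusedLevels, ih hs, h (t + 1) (by simp)]

lemma spentLevel_congr {S : Multiset ℝ} {m m' : ℕ → Merge n} {t : ℕ}
    (h : ∀ s ∈ Finset.Icc 1 (t + 1), m s = m' s) :
    spentLevel nMin nStar S m t = spentLevel nMin nStar S m' t := by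
  rw [spentLevel, spentLevel, h (t + 1) (by simp), unusedLevels_congr fun s hs => h s (by
    simp only [Finset.mem_Icc] at hs ⊢
    omega)]

/-- A nonempty finite set attains its infimum and supremum, so the subsequent `erase` does remove
the level spent. -/
lemma testLevel_mem {S : Multiset ℝ} (hS : S ≠ 0) (N : Merge n) : testLevel nStar S N ∈ S := by
  have hfin : {a | a ∈ S}.Finite := S.finite_toSet
  have hne : {a | a ∈ S}.Nonempty := Multiset.exists_mem_of_ne_zero hS
  unfold testLevel
  split_ifs
  · exact hne.csInf_mem hfin
  · exact hne.csSup_mem hfin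

lemma unusedLevels_le (S : Multiset ℝ) (m : ℕ → Merge n) (t : ℕ) :
    unusedLevels nMin nStar S m t ≤ S := by
  induction t with
  | zero => exact le_rfl
  | succ t ih =>
    rw [unusedLevels]
    split_ifs
    · exact ih
    · exact (Multiset.erase_le _ _).trans ih

lemma card_le_card_unusedLevels_add (S : Multiset ℝ) (m : ℕ → Merge n) (t : ℕ) :
    S.card ≤ (unusedLevels nMin nStar S m t).card + t := by
  induction t with
  | zero => exact le_rfl
  | succ t ih =>
    rw [unusedLevels]
    split_ifs
    · omega
    · set U := unusedLevels nMin nStar S m t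
      set b := testLevel nStar U (m (t + 1))
      have h1 : U.card ≤ (b ::ₘ U.erase b).card := Multiset.card_le_card (Multiset.le_cons_erase U b)
      rw [Multiset.card_cons] at h1
      omega

lemma unusedLevels_ne_zero {S : Multiset ℝ} (m : ℕ → Merge n) {t : ℕ} (ht : t < S.card) :
    unusedLevels nMin nStar S m t ≠ 0 := by
  intro h
  have := card_le_card_unusedLevels_add (nMin := nMin) (nStar := nStar) S m t
  rw [h, Multiset.card_zero] at this
  omega

lemma spentLevel_nonneg {S : Multiset ℝ} (hS : ∀ a ∈ S, 0 ≤ a) (m : ℕ → Merge n) {t : ℕ}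
    (ht : t < S.card) : 0 ≤ spentLevel nMin nStar S m t := by
  unfold spentLevel
  split_ifs
  · exact le_rfl
  · exact hS _ (Multiset.mem_of_le (unusedLevels_le S m t)
      (testLevel_mem (unusedLevels_ne_zero m ht) _))

/-- Conservation: each step moves at most one level from the unused multiset to the spent sum. The
bound on `t` guarantees that a level is still available when a test needs one. -/
lemma sum_spentLevel_add {S : Multiset ℝ} (m : ℕ → Merge n) {t : ℕ} (ht : t ≤ S.card) :
    ∑ s ∈ Finset.range t, spentLevel nMin nStar S m s + (unusedLevels nMin nStar S m t).sum =
      S.sum := by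
  induction t with
  | zero => simp [unusedLevels]
  | succ t ih =>
    rw [Finset.sum_range_succ, ← ih (by omega), unusedLevels, spentLevel, add_assoc]
    congr 1
    split_ifs
    · rw [zero_add]
    · rw [← Multiset.sum_cons,
        Multiset.cons_erase (testLevel_mem (unusedLevels_ne_zero m (by omega)) _)]

lemma sum_spentLevel_le {S : Multiset ℝ} (hS : ∀ a ∈ S, 0 ≤ a) (m : ℕ → Merge n) :
    ∑ s ∈ Finset.range S.card, spentLevel nMin nStar S m s ≤ S.sum := by
  rw [← sum_spentLevel_add (nMin := nMin) (nStar := nStar) m le_rfl, le_add_iff_nonneg_right]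
  exact Multiset.sum_nonneg fun a ha => hS a (Multiset.mem_of_le (unusedLevels_le S m _) ha)

/-- If the procedure returns more than `K` clusters, then some test rejected. -/
lemma exists_reject_of_lt_spend {K : ℕ} (hK : 1 ≤ K) {S : Multiset ℝ} (m : ℕ → Merge n)
    (x : Data n p) (k t : ℕ)
    (h : K < spend d τ nMin nStar m x k (t + 1) (unusedLevels nMin nStar S m t)) :
    ∃ s, t ≤ s ∧ s < t + k ∧ ¬ minSize (m (s + 1)) ≤ nMin ∧
      pValue d τ m (s + 1) x < spentLevel nMin nStar S m s ∧ K < n - (s + 1) + 1 := by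
  induction k generalizing t with
  | zero =>
    -- Without a rejection the procedure returns `1`, which does not exceed `K`.
    rw [spend] at h
    omega
  | succ k ih =>
    have step : K < spend d τ nMin nStar m x k (t + 1 + 1) (unusedLevels nMin nStar S m (t + 1)) →
        ∃ s, t ≤ s ∧ s < t + (k + 1) ∧ ¬ minSize (m (s + 1)) ≤ nMin ∧
          pValue d τ m (s + 1) x < spentLevel nMin nStar S m s ∧ K < n - (s + 1) + 1 := by
      intro h'
      obtain ⟨s, h1, h2, h3⟩ := ih (t + 1) h'
      exact ⟨s, by omega, by omega, h3⟩
    rw [spend] at h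
    split_ifs at h with h1 h2
    · exact step (by rwa [unusedLevels, if_pos h1])
    · exact ⟨t, le_rfl, by omega, h1, by rwa [spentLevel, if_neg h1], h⟩
    · exact step (by rwa [unusedLevels, if_neg h1])

end Levels

/-! ### From fixed histories to the random run -/

section Run

variable {n p : ℕ} {Ω : Type*} [MeasurableSpace Ω] {P : Measure Ω} {μ : Data n p} {σ : ℝ≥0}
  {d : Merge n → Data n p → ℝ} {τ : ℝ} {X : Ω → Data n p} {M : ℕ → Ω → Merge n}

/-- Conditionally on the first `t` merges, the p-value of step `t` is below `u` with probability at
most `u`, if the two clusters merged at step `t` have a common mean. -/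
lemma IsClusteringRun.measure_pValue_lt_le (hrun : IsClusteringRun P μ σ d τ X M) (hp : 1 ≤ p)
    (hd : ∀ c, Measurable (d c)) (hσ : 0 < σ) (m : ℕ → Merge n) {t : ℕ} (ht : 1 ≤ t)
    (htn : t ≤ n - 1) (h1 : 2 ≤ (m t).1.card) (h2 : 2 ≤ (m t).2.card)
    (hμ : ∀ i ∈ (m t).1 ∪ (m t).2, ∀ j ∈ (m t).1 ∪ (m t).2, μ i = μ j)
    {u : ℝ} (hu : 0 ≤ u) :
    P {ω | X ω ∈ {x | pValue d τ m t x < u} ∧ ∀ s ∈ Finset.Icc 1 t, M s ω = m s} ≤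
      ENNReal.ofReal u * P {ω | ∀ s ∈ Finset.Icc 1 t, M s ω = m s} := by
  have huniv := hrun.law_merges t htn m univ MeasurableSet.univ
  simp only [mem_univ, true_and, Measure.restrict_univ] at huniv
  rw [hrun.law_merges t htn m _ (measurableSet_lt (measurable_pValue hd m t) measurable_const),
    huniv]
  -- Disjointness of the merged clusters is available only for possible histories; for an impossible
  -- one both sides vanish.
  by_cases h0 : ∃ x, historyProb d τ m t x ≠ 0
  · obtain ⟨x, hx⟩ := h0
    exact setLIntegral_pValue_lt_le hp hd m t (disjoint_of_historyProb_ne_zero ht hx) h1 h2 hμ hσ hu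
  · push Not at h0
    simp [h0]

/-- Extension of a finite merge history by a dummy merge. -/
def extendHistory {t : ℕ} (h : Finset.Icc 1 t → Merge n) (s : ℕ) : Merge n :=
  if hs : s ∈ Finset.Icc 1 t then h ⟨s, hs⟩ else (∅, ∅)

lemma extendHistory_restrict {t : ℕ} (m : ℕ → Merge n) {s : ℕ} (hs : s ∈ Finset.Icc 1 t) :
    extendHistory (fun r : Finset.Icc 1 t => m r) s = m s := by
  rw [extendHistory, dif_pos hs]

/-- The cutoff `nMin ≥ 1` keeps the within-cluster degrees of freedom positive at every tested
merge. -/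
lemma lt_card_of_lt_minSize {nMin : ℝ} (hMin : 1 ≤ nMin) {N : Merge n} (h : ¬ minSize N ≤ nMin) :
    2 ≤ N.1.card ∧ 2 ≤ N.2.card := by
  have h1 : (1 : ℝ) < ((min N.1.card N.2.card : ℕ) : ℝ) := lt_of_le_of_lt hMin (not_le.1 h)
  have h2 : 1 < min N.1.card N.2.card := by exact_mod_cast h1
  exact le_min_iff.1 h2

/-- The first `t` merges take finitely many values, so such a functional is a finite sum of
indicators of history events. -/
lemma IsClusteringRun.lintegral_comp_history (hrun : IsClusteringRun P μ σ d τ X M) {t : ℕ}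
    (htn : t ≤ n - 1) (f : (ℕ → Merge n) → ℝ≥0∞)
    (hf : ∀ m m' : ℕ → Merge n, (∀ s ∈ Finset.Icc 1 t, m s = m' s) → f m = f m') :
    (Measurable fun ω => f fun s => M s ω) ∧
    ∫⁻ ω, f (fun s => M s ω) ∂P = ∑ h : Finset.Icc 1 t → Merge n, f (extendHistory h) *
      P {ω | ∀ s ∈ Finset.Icc 1 t, M s ω = extendHistory h s} := by
  classical
  have hF : ∀ h : Finset.Icc 1 t → Merge n,
      MeasurableSet {ω | ∀ s ∈ Finset.Icc 1 t, M s ω = extendHistory h s} := by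
    intro h
    have : {ω | ∀ s ∈ Finset.Icc 1 t, M s ω = extendHistory h s} =
        ⋂ s ∈ Finset.Icc 1 t, {ω | M s ω = extendHistory h s} := by
      ext ω
      simp
    rw [this]
    refine Finset.measurableSet_biInter _ fun s hs => hrun.measurable_merge s ?_ _
    simp only [Finset.mem_Icc] at hs ⊢
    omega
  have hsum : (fun ω => f fun s => M s ω) = fun ω => ∑ h : Finset.Icc 1 t → Merge n,
      {ω | ∀ s ∈ Finset.Icc 1 t, M s ω = extendHistory h s}.indicator
        (fun _ => f (extendHistory h)) ω := by
    funext ω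
    rw [Finset.sum_eq_single fun r : Finset.Icc 1 t => M r ω]
    · rw [indicator_of_mem]
      · exact hf _ _ fun s hs => (extendHistory_restrict (fun s => M s ω) hs).symm
      · exact fun s hs => (extendHistory_restrict (fun s => M s ω) hs).symm
    · intro h _ hne
      refine indicator_of_notMem (fun hω => hne ?_) _
      funext r
      have := hω r r.2
      rw [extendHistory, dif_pos r.2] at this
      exact this.symm
    · simp
  refine ⟨?_, ?_⟩
  · rw [hsum]
    exact Finset.measurable_fun_sum _ fun h _ => measurable_const.indicator (hF h)
  · rw [hsum, lintegral_finsetSum _ fun h _ => measurable_const.indicator (hF h)]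
    exact Finset.sum_congr rfl fun h _ => lintegral_indicator_const (hF h) _

/-- Once the first `t + 1` merges are fixed, the level is a constant and the truth of the null is
decided. Conditional validity applies to each history, and summing yields the expected spent level.
-/
lemma IsClusteringRun.measure_reject_le (hrun : IsClusteringRun P μ σ d τ X M) (hp : 1 ≤ p)
    (hd : ∀ c, Measurable (d c)) (hσ : 0 < σ) {nMin nStar : ℝ} (hMin : 1 ≤ nMin)
    {S : Multiset ℝ} (hS : ∀ a ∈ S, 0 ≤ a) (hcard : S.card = n - 1) {t : ℕ} (ht : t < n - 1) :
    P {ω | ¬ minSize (M (t + 1) ω) ≤ nMin ∧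
        (∀ i ∈ (M (t + 1) ω).1 ∪ (M (t + 1) ω).2, ∀ j ∈ (M (t + 1) ω).1 ∪ (M (t + 1) ω).2,
          μ i = μ j) ∧
        pValue d τ (fun s => M s ω) (t + 1) (X ω) < spentLevel nMin nStar S (fun s => M s ω) t} ≤
      ∫⁻ ω, ENNReal.ofReal (spentLevel nMin nStar S (fun s => M s ω) t) ∂P := by
  classical
  rw [(hrun.lintegral_comp_history (t := t + 1) (by omega)
    (fun m => ENNReal.ofReal (spentLevel nMin nStar S m t))
    fun m m' h => by rw [spentLevel_congr h]).2]
  let E : (Finset.Icc 1 (t + 1) → Merge n) → Set Ω := fun h =>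
    {ω | (¬ minSize (extendHistory h (t + 1)) ≤ nMin ∧
      ∀ i ∈ (extendHistory h (t + 1)).1 ∪ (extendHistory h (t + 1)).2,
        ∀ j ∈ (extendHistory h (t + 1)).1 ∪ (extendHistory h (t + 1)).2, μ i = μ j) ∧
      X ω ∈ {x | pValue d τ (extendHistory h) (t + 1) x <
        spentLevel nMin nStar S (extendHistory h) t} ∧
      ∀ s ∈ Finset.Icc 1 (t + 1), M s ω = extendHistory h s}
  have hsub : {ω | ¬ minSize (M (t + 1) ω) ≤ nMin ∧
        (∀ i ∈ (M (t + 1) ω).1 ∪ (M (t + 1) ω).2, ∀ j ∈ (M (t + 1) ω).1 ∪ (M (t + 1) ω).2,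
          μ i = μ j) ∧
        pValue d τ (fun s => M s ω) (t + 1) (X ω) < spentLevel nMin nStar S (fun s => M s ω) t} ⊆
      ⋃ h ∈ (Finset.univ : Finset (Finset.Icc 1 (t + 1) → Merge n)), E h := by
    rintro ω ⟨h1, h2, h3⟩
    simp only [mem_iUnion, Finset.mem_univ, exists_true_left]
    refine ⟨fun r => M r ω, ?_⟩
    have hag : ∀ s ∈ Finset.Icc 1 (t + 1), M s ω =
        extendHistory (fun r : Finset.Icc 1 (t + 1) => M r ω) s := fun s hs =>
      (extendHistory_restrict (fun s => M s ω) hs).symm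
    have ht1 := hag (t + 1) (by simp)
    refine ⟨⟨by rwa [← ht1], by rwa [← ht1]⟩, ?_, hag⟩
    rw [pValue_congr (by omega) hag, spentLevel_congr hag] at h3
    exact h3
  refine (measure_mono hsub).trans ((measure_biUnion_finset_le _ _).trans ?_)
  refine Finset.sum_le_sum fun h _ => ?_
  -- Histories whose last merge is untested or has a false null contribute the empty event.
  by_cases hh : ¬ minSize (extendHistory h (t + 1)) ≤ nMin ∧
      ∀ i ∈ (extendHistory h (t + 1)).1 ∪ (extendHistory h (t + 1)).2,
        ∀ j ∈ (extendHistory h (t + 1)).1 ∪ (extendHistory h (t + 1)).2, μ i = μ j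
  · obtain ⟨c1, c2⟩ := lt_card_of_lt_minSize hMin hh.1
    exact (measure_mono fun ω hω => hω.2).trans (hrun.measure_pValue_lt_le hp hd hσ _ (by omega)
      (by omega) c1 c2 hh.2 (spentLevel_nonneg hS _ (by omega)))
  · have : E h = ∅ := eq_empty_of_forall_notMem fun ω hω => hh hω.1
    simp [this]

end Run

end RandClust

end

/-! ### Union bound over the steps -/

theorem theorem3 {n p K : ℕ} (hn : 1 ≤ n) (hp : 1 ≤ p)
    {Ω : Type*} [MeasurableSpace Ω] (P : Measure Ω) [IsProbabilityMeasure P]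
    (μ : RandClust.Data n p) (σ : ℝ≥0) (hσ : 0 < σ)
    (z : Fin n → Fin K) (hz : Function.Surjective z) (hμ : ∀ i j, z i = z j → μ i = μ j)
    (d : RandClust.Merge n → RandClust.Data n p → ℝ) (hd : ∀ c, Measurable (d c))
    (τ : ℝ) (hτ : 0 < τ)
    (X : Ω → RandClust.Data n p) (M : ℕ → Ω → RandClust.Merge n)
    (hrun : RandClust.IsClusteringRun P μ σ d τ X M)
    (nMin nStar : ℝ) (hMin : 1 ≤ nMin)
    (a : Fin (n - 1) → ℝ) (ha : ∀ j, 0 ≤ a j) (α : ℝ) (hα : ∑ j, a j = α) :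
    P ({ω | K < RandClust.kHat d τ nMin nStar a (fun t => M t ω) (X ω)} ∩
        {ω | RandClust.NoCrossMerge z (fun t => M t ω)}) ≤ ENNReal.ofReal α := by
  have hK : 1 ≤ K := Nat.one_le_iff_ne_zero.2 fun h => (h ▸ z ⟨0, hn⟩ : Fin 0).elim0
  set S : Multiset ℝ := Finset.univ.val.map a with hSdef
  have hS : ∀ b ∈ S, 0 ≤ b := by
    intro b hb
    obtain ⟨j, -, rfl⟩ := Multiset.mem_map.1 hb
    exact ha j
  have hcard : S.card = n - 1 := by simp [hSdef]
  have hsum : S.sum = α := hα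
  let E : ℕ → Set Ω := fun t => {ω | ¬ RandClust.minSize (M (t + 1) ω) ≤ nMin ∧
    (∀ i ∈ (M (t + 1) ω).1 ∪ (M (t + 1) ω).2, ∀ j ∈ (M (t + 1) ω).1 ∪ (M (t + 1) ω).2,
      μ i = μ j) ∧
    RandClust.pValue d τ (fun s => M s ω) (t + 1) (X ω) <
      RandClust.spentLevel nMin nStar S (fun s => M s ω) t}
  have hsub : {ω | K < RandClust.kHat d τ nMin nStar a (fun t => M t ω) (X ω)} ∩
      {ω | RandClust.NoCrossMerge z (fun t => M t ω)} ⊆ ⋃ t ∈ Finset.range (n - 1), E t := by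
    rintro ω ⟨h1, h2⟩
    obtain ⟨t, -, ht, hmin, hpv, hKt⟩ := RandClust.exists_reject_of_lt_spend (S := S) hK
      (fun t => M t ω) (X ω) (n - 1) 0 h1
    refine Set.mem_biUnion (x := t) (by simpa using ht) ⟨hmin, fun i hi j hj => ?_, hpv⟩
    -- A rejection at step `t + 1` returns `n - (t + 1) + 1 > K`, so `t + 1 < n - K + 1`: the step
    -- lies in the range where no cross-cluster merge occurs, and the null is true.
    exact hμ i j (h2 (t + 1) (by omega) (by omega) i hi j hj)
  calc _ ≤ ∑ t ∈ Finset.range (n - 1), P (E t) :=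
        (measure_mono hsub).trans (measure_biUnion_finset_le _ _)
    _ ≤ ∑ t ∈ Finset.range (n - 1), ∫⁻ ω, ENNReal.ofReal
          (RandClust.spentLevel nMin nStar S (fun s => M s ω) t) ∂P :=
        Finset.sum_le_sum fun t ht =>
          hrun.measure_reject_le hp hd hσ hMin hS hcard (Finset.mem_range.1 ht)
    _ = ∫⁻ ω, ∑ t ∈ Finset.range (n - 1), ENNReal.ofReal
          (RandClust.spentLevel nMin nStar S (fun s => M s ω) t) ∂P := by
        refine (lintegral_finsetSum _ fun t ht => ?_).symm
        have ht' := Finset.mem_range.1 ht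
        exact (hrun.lintegral_comp_history (t := t + 1) (by omega)
          (fun m => ENNReal.ofReal (RandClust.spentLevel nMin nStar S m t))
          fun m m' h => by rw [RandClust.spentLevel_congr h]).1
    _ ≤ ∫⁻ _, ENNReal.ofReal α ∂P := by
        -- The levels are random, but along every realized history their sum is at most `α`.
        refine lintegral_mono fun ω => ?_
        rw [← ENNReal.ofReal_sum_of_nonneg fun t ht =>
          RandClust.spentLevel_nonneg hS _ (by rw [hcard]; exact Finset.mem_range.1 ht)]
        refine ENNReal.ofReal_le_ofReal ?_
        rw [← hcard, ← hsum]
        exact RandClust.sum_spentLevel_le hS _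
    _ = ENNReal.ofReal α := by simp
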